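/- There is a universal constant $C>0$ such that the following holds. Let $n\ge 1$ and $k\ge 1$ be integers with $k\le \ln n$, and let $\varepsilon\in(0,1)$. There is a deterministic streaming algorithm that, for every undirected simple graph $G=(V,E,w)$ on the vertex set $V=\{0,\dots,n-1\}$ with non-negative edge weights, every source $s\in V$, and every insertion-only stream of $G$ (each edge arrives exactly once together with its weight, in an arbitrary order, the same in all passes), outputs a $(1+\varepsilon)$-approximate shortest path tree of $G$ rooted at $s$, using at most $$C\cdot\frac{k^2}{\varepsilon^2}\cdot n^{1+1/k}\cdot\log_2^4 n\ \text{ words of space}\qquad\text{and at most}\qquad C\cdot\frac{k^2}{\varepsilon}\ \text{ passes over the stream.}$$ Here a word has $b$ bits, where $b$ is any number such that a word can hold the name of a vertex ($n\le 2^b$) and the weight of an edge (the weights are taken from a set $\mathcal W\subset[0,\infty)$, fixed in advance, with $|\mathcal W|\le 2^b$); $C$ does not depend on $b$ or $\mathcal W$. A deterministic streaming algorithm for given $n,k,\varepsilon,b,\mathcal W$ consists of an initial memory content depending on $s$, a map that updates the memory when an edge arrives, a map that updates it at the end of a pass, and a map that reads the output off the final memory; space is the number of words of memory, and local computation is not charged.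 A $(1+\varepsilon)$-approximate shortest path tree rooted at $s$ is a tree $T\subseteq G$ that contains $s$, spans the connected component of $s$ in $G$, and satisfies $\mathrm{dist}_T(s,t)\le(1+\varepsilon)\,\mathrm{dist}_G(s,t)$ for every vertex $t$ of that component. -/

import Mathlib

open scoped NNReal ENNReal

namespace StreamSSSP

/-- The total weight of a walk. -/
noncomputable def walkWeight {V : Type*} {G : SimpleGraph V} (w : Sym2 V → ℝ≥0) {u v : V}
    (p : G.Walk u v) : ℝ≥0 :=
  (p.edges.map w).sum

/-- The weighted distance from `u` to `v` in `G`, the least total weight of a walk between them;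
it is `∞` if `v` cannot be reached from `u`.  Only the weights of edges of `G` matter. -/
noncomputable def wdist {V : Type*} (G : SimpleGraph V) (w : Sym2 V → ℝ≥0) (u v : V) : ℝ≥0∞ :=
  ⨅ p : G.Walk u v, (walkWeight w p : ℝ≥0∞)

/-- `T` is a `c`-approximate shortest path tree of the weighted graph `(G, w)` rooted at `s`:
a subgraph of `G` that is a tree containing the root `s` (it has no cycle, and all its edges
hang on `s`; other vertices are isolated in `T` and are not regarded as part of the tree),
whose distances from `s` are at most `c` times those of `G`.  For `c` positive, the last condition
makes `T` span the connected component of `s` in `G`. -/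
structure IsApproxShortestPathTree {V : Type*} (G : SimpleGraph V) (w : Sym2 V → ℝ≥0) (s : V)
    (c : ℝ) (T : SimpleGraph V) : Prop where
  le : T ≤ G
  acyclic : T.IsAcyclic
  rooted : ∀ u v, T.Adj u v → T.Reachable s u
  approx : ∀ t, wdist T w s t ≤ ENNReal.ofReal c * wdist G w s t

/-- An item of the stream: an undirected edge on the vertices `0, …, n - 1`, with its weight. -/
abbrev Item (n : ℕ) : Type := Sym2 (Fin n) × ℝ≥0

/-- An insertion-only stream of `(G, w)`: every edge of `G` arrives exactly once, together with its
weight, in an arbitrary order. -/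
def IsInsertionStream {n : ℕ} (G : SimpleGraph (Fin n)) (w : Sym2 (Fin n) → ℝ≥0)
    (σ : List (Item n)) : Prop :=
  ∃ l : List (Sym2 (Fin n)), l.Nodup ∧ (∀ e, e ∈ l ↔ e ∈ G.edgeSet) ∧
    σ = l.map fun e => (e, w e)

/-- A memory of `m` machine words of `b` bits each. -/
abbrev Memory (m b : ℕ) : Type := Fin m → Fin (2 ^ b)

/-- A deterministic streaming algorithm for graphs on `n` vertices with a source vertex, using `m`
words of `b` bits.  The memory is all that it carries from one moment to the next: in
particular the number of the current pass and the position in the stream are available only as far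
as they are recorded there.  As usual for streaming algorithms, the resources are space and passes,
and the time spent on local computations is not restricted. -/
structure DetAlgorithm (n m b : ℕ) where
  /-- the initial memory, given the source vertex -/
  init : Fin n → Memory m b
  /-- the new memory when an item of the stream arrives -/
  step : Memory m b → Item n → Memory m b
  /-- the new memory when the end of the stream is reached -/
  endPass : Memory m b → Memory m b
  /-- the graph that is output, read off the final memory -/
  output : Memory m b → SimpleGraph (Fin n)

/-- The effect of one pass over the stream `σ` on the memory. -/
def DetAlgorithm.pass {n m b : ℕ} (A : DetAlgorithm n m b) (σ : List (Item n))
    (M : Memory m b) : Memory m b :=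
  A.endPass (σ.foldl A.step M)

/-- The output of the algorithm on source `s` after `p` passes over the stream `σ`. -/
def DetAlgorithm.run {n m b : ℕ} (A : DetAlgorithm n m b) (p : ℕ) (s : Fin n)
    (σ : List (Item n)) : SimpleGraph (Fin n) :=
  A.output ((A.pass σ)^[p] (A.init s))

end StreamSSSP

/-!
The algorithm is an instance of the multiplicative weights method.  It collects `T = O(k ^ 2 / ε)`
trees, and outputs a shortest path tree of their union.  The distances from `s` in one of the trees
form a potential, and an edge is *violated* by the tree if its potential differs by more than the
weight of the edge between its ends.  The distance of a vertex in the union of the trees is at most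
the average of the potentials of all trees, so it suffices that along every edge of `G` this
average grows by at most `1 + ε` times the weight of the edge (`sum_potential_le`).

Two facts achieve this.  On the one hand, every tree is a shortest path tree of a stored graph that
contains a spanner of `G`, so that a violated edge is stretched by a factor of at most `6 * k`
(`IsSpannerOf.wdist_le`).  On the other hand, no edge is violated by more than `3 * k` trees
(`violationCount_treesAfter_le`).  For this, an edge that is violated by `j` trees has importance
`g ^ j`, where `g` is about `n ^ (1 / k)`.  The stored graph also contains a net of the edges with
respect to their importance: a potential that violates no edge of the net violates only edges with a
fraction `1 / (2 * g * T)` of the total importance, in each of the two directions.  A new tree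
violates no stored edge, therefore it increases the total importance by a factor of at most
`1 + 1 / T` only (`importance_newTree_le`).  The total importance never exceeds `n ^ 3`, and no edge
can have reached a higher importance than `n ^ 3 ≤ g ^ (3 * k)`.

The net is found deterministically in one pass by merge and reduce: blocks of `N` edges sit in the
digits of a binary counter, and a carry merges two blocks and keeps one half of them
(`SummaryRepresents.violCount_le`).  A good half exists by the method of conditional expectations
(`exists_half_of_ranges`), since the sets of violated edges have Vapnik-Chervonenkis dimension at
most `n` (`card_le_of_shatters`), whence there are few of them.

The first two passes find the spanner.  The first one maintains a bottleneck forest.  The second one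
runs the greedy spanner algorithm separately for the edges of each scale, that is with weights in
`[2 ^ i, 2 ^ (i + 1))`, after contraction of the forest edges of weight at most `2 ^ i / n`.  The
greedy spanners have no cycles of length at most `2 * k`, so that they have at most `n ^ (1 / k)`
edges per vertex (`card_edges_le_of_girth`).  A forest edge can keep a vertex of the contracted
graph from being isolated only at `O(log n)` scales, which bounds the size of all the spanners
together (`IsSpannerOf.length_le`).

Local computation is free, so the operations on the memory may be chosen by mere existence, and the
memory has enough words as soon as the states that can occur are few enough (`exists_detAlgorithm`).
-/

namespace StreamSSSP

/-! ### Weighted distances -/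

section Distance

variable {V : Type*} {G H : SimpleGraph V} {w : Sym2 V → ℝ≥0}

@[simp] lemma walkWeight_nil (u : V) : walkWeight w (SimpleGraph.Walk.nil : G.Walk u u) = 0 := rfl

@[simp] lemma walkWeight_cons {u v x : V} (h : G.Adj u v) (p : G.Walk v x) :
    walkWeight w (SimpleGraph.Walk.cons h p) = w s(u, v) + walkWeight w p := by
  simp [walkWeight]

lemma walkWeight_append {u v x : V} (p : G.Walk u v) (q : G.Walk v x) :
    walkWeight w (p.append q) = walkWeight w p + walkWeight w q := by
  simp [walkWeight]

lemma walkWeight_reverse {u v : V} (p : G.Walk u v) :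
    walkWeight w p.reverse = walkWeight w p := by
  simp [walkWeight, List.sum_reverse]

lemma wdist_le {u v : V} (p : G.Walk u v) : wdist G w u v ≤ walkWeight w p := iInf_le _ p

@[simp] lemma wdist_self (u : V) : wdist G w u u = 0 := by
  simpa using wdist_le (w := w) (SimpleGraph.Walk.nil : G.Walk u u)

lemma wdist_comm (u v : V) : wdist G w u v = wdist G w v u := by
  have key : ∀ u v, wdist G w u v ≤ wdist G w v u := fun u v ↦ le_iInf fun p ↦ by
    simpa [walkWeight_reverse] using wdist_le (w := w) p.reverse
  exact le_antisymm (key u v) (key v u)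

lemma wdist_triangle (u v x : V) : wdist G w u x ≤ wdist G w u v + wdist G w v x := by
  simp only [wdist, ENNReal.iInf_add, ENNReal.add_iInf]
  refine le_iInf fun q ↦ le_iInf fun p ↦ ?_
  have := wdist_le (w := w) (p.append q)
  simpa [walkWeight_append, wdist] using this

lemma wdist_adj {u v : V} (h : G.Adj u v) : wdist G w u v ≤ w s(u, v) := by
  simpa using wdist_le (w := w) (SimpleGraph.Walk.cons h .nil)

lemma wdist_anti (h : G ≤ H) (u v : V) : wdist H w u v ≤ wdist G w u v :=
  le_iInf fun p ↦ by
    have := wdist_le (w := w) (p.mapLe h)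
    simpa [walkWeight] using this

lemma wdist_congr {w' : Sym2 V → ℝ≥0} (h : ∀ e ∈ G.edgeSet, w e = w' e) (u v : V) :
    wdist G w u v = wdist G w' u v := by
  refine iInf_congr fun p ↦ ?_
  have : p.edges.map w = p.edges.map w' :=
    List.map_congr_left fun e he ↦ h e (p.edges_subset_edgeSet he)
  simp [walkWeight, this]

lemma wdist_ne_top_iff {u v : V} : wdist G w u v ≠ ∞ ↔ G.Reachable u v := by
  constructor
  · intro h
    by_contra hr
    have : IsEmpty (G.Walk u v) := not_nonempty_iff.1 hr
    exact h (by simp [wdist])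
  · rintro ⟨p⟩
    exact ((wdist_le (w := w) p).trans_lt ENNReal.coe_lt_top).ne

/-- A walk that leaves a set of vertices is at least as long as its part up to the first edge
leaving the set. -/
lemma exists_crossing (R : Set V) {y x : V} (p : G.Walk y x) (hy : y ∈ R) (hx : x ∉ R) :
    ∃ a b, a ∈ R ∧ b ∉ R ∧ G.Adj a b ∧
      wdist G w y a + w s(a, b) ≤ walkWeight w p := by
  induction p with
  | nil => exact absurd hy hx
  | @cons y z x h p ih =>
    by_cases hz : z ∈ R
    · obtain ⟨a, b, ha, hb, hab, hle⟩ := ih hz hx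
      refine ⟨a, b, ha, hb, hab, ?_⟩
      calc _ ≤ (wdist G w y z + wdist G w z a) + w s(a, b) := by
            gcongr; exact wdist_triangle ..
        _ ≤ w s(y, z) + (wdist G w z a + w s(a, b)) := by
            rw [add_assoc]; gcongr; exact wdist_adj h
        _ ≤ _ := by rw [walkWeight_cons]; push_cast; gcongr
    · exact ⟨y, z, hy, hz, h, by simp⟩

end Distance

/-! ### Shortest path trees and bottleneck forests -/

section Trees

variable {V : Type*} [Fintype V]

/-- Prim-style growth: a tree with exact distances on a set of vertices is extended by the edge
leaving the set that minimizes distance plus weight. -/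
lemma exists_shortestPathTree (H : SimpleGraph V) (w : Sym2 V → ℝ≥0) (s : V) :
    ∃ T ≤ H, T.IsAcyclic ∧ (∀ u v, T.Adj u v → T.Reachable s u) ∧
      ∀ t, wdist T w s t = wdist H w s t := by
  classical
  let P : Set (Finset V × SimpleGraph V) := {X | s ∈ X.1 ∧ X.2 ≤ H ∧ X.2.IsAcyclic ∧
    (∀ u v, X.2.Adj u v → u ∈ X.1) ∧ (∀ t ∈ X.1, X.2.Reachable s t) ∧
    ∀ t ∈ X.1, wdist X.2 w s t = wdist H w s t}
  have hP : P.Nonempty := by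
    refine ⟨({s}, ⊥), ?_, ?_, ?_, ?_, ?_, ?_⟩ <;> simp
  obtain ⟨⟨R, T⟩, ⟨hs, hTH, hac, hsupp, hreach, hdist⟩, hmax⟩ :=
    (Set.toFinite P).exists_maximalFor (fun X ↦ X.1.card) P hP
  simp only at hs hTH hac hsupp hreach hdist hmax
  have hall : ∀ t, H.Reachable s t → t ∈ R := by
    rintro t ⟨p⟩
    by_contra ht
    -- the crossing edge minimizing distance plus weight
    let cross : Finset (V × V) := {e | e.1 ∈ R ∧ e.2 ∉ R ∧ H.Adj e.1 e.2}
    have hne : cross.Nonempty := by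
      obtain ⟨a, b, ha, hb, hab, -⟩ := exists_crossing (w := w) (R : Set V) p hs ht
      exact ⟨(a, b), by simpa [cross] using ⟨ha, hb, hab⟩⟩
    obtain ⟨⟨u, v⟩, huv, hmin⟩ := cross.exists_min_image
      (fun e ↦ wdist H w s e.1 + w s(e.1, e.2)) hne
    simp only [cross, Finset.mem_filter, Finset.mem_univ, true_and] at huv hmin
    obtain ⟨hu, hv, hadj⟩ := huv
    have hdv : wdist H w s u + w s(u, v) ≤ wdist H w s v := le_iInf fun q ↦ by
      obtain ⟨a, b, ha, hb, hab, hle⟩ := exists_crossing (w := w) (R : Set V) q hs hv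
      exact (hmin (a, b) ⟨ha, hb, hab⟩).trans hle
    have hnr : ¬ T.Reachable u v := by
      rintro ⟨q⟩
      have hq : q.reverse.length ≠ 0 := by
        intro h0
        rw [SimpleGraph.Walk.length_reverse] at h0
        exact hv (SimpleGraph.Walk.eq_of_length_eq_zero h0 ▸ hu)
      cases hqr : q.reverse with
      | nil => simp [hqr] at hq
      | cons h _ => exact hv (hsupp _ _ h)
    have hne : u ≠ v := fun h ↦ hv (h ▸ hu)
    have hle : T ≤ T ⊔ SimpleGraph.edge u v := le_sup_left
    have hadj' : (T ⊔ SimpleGraph.edge u v).Adj u v := by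
      simp [SimpleGraph.edge_adj, hne]
    have hTH' : T ⊔ SimpleGraph.edge u v ≤ H := by
      refine sup_le hTH fun a b hab ↦ ?_
      rw [SimpleGraph.edge_adj] at hab
      rcases hab with ⟨⟨rfl, rfl⟩ | ⟨rfl, rfl⟩, -⟩
      exacts [hadj, hadj.symm]
    have hmem : ((insert v R, T ⊔ SimpleGraph.edge u v) : Finset V × SimpleGraph V) ∈ P := by
      refine ⟨by simp [hs], hTH', hac.sup_edge_of_not_reachable hnr, ?_, ?_, ?_⟩
      · intro a b hab
        simp only [SimpleGraph.sup_adj, SimpleGraph.edge_adj] at hab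
        rcases hab with hab | ⟨⟨rfl, rfl⟩ | ⟨rfl, rfl⟩, -⟩
        · simp [hsupp _ _ hab]
        · simp [hu]
        · simp
      · intro t ht
        rcases Finset.mem_insert.1 ht with rfl | ht
        · exact ((hreach u hu).mono hle).trans hadj'.reachable
        · exact (hreach t ht).mono hle
      · intro t ht
        refine le_antisymm ?_ (wdist_anti hTH' _ _)
        rcases Finset.mem_insert.1 ht with rfl | ht
        · calc _ ≤ wdist (T ⊔ SimpleGraph.edge u t) w s u +
                  wdist (T ⊔ SimpleGraph.edge u t) w u t := wdist_triangle ..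
            _ ≤ wdist T w s u + w s(u, t) := by
                gcongr
                exacts [wdist_anti hle _ _, wdist_adj hadj']
            _ ≤ _ := by rw [hdist u hu]; exact hdv
        · exact (wdist_anti hle _ _).trans (hdist t ht).le
    have := hmax hmem (by simp [Finset.card_insert_of_notMem hv])
    simp [Finset.card_insert_of_notMem hv] at this
  refine ⟨T, hTH, hac, fun u v h ↦ hreach u (hsupp u v h), fun t ↦ ?_⟩
  by_cases ht : H.Reachable s t
  · exact hdist t (hall t ht)
  · have h1 : wdist H w s t = ∞ := by
      by_contra h; exact ht (wdist_ne_top_iff.1 h)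
    exact le_antisymm (h1 ▸ le_top) (wdist_anti hTH _ _)

lemma card_lt_of_isAcyclic [Nonempty V] {F : Finset (Sym2 V)} (hd : ∀ e ∈ F, ¬ e.IsDiag)
    (hF : (SimpleGraph.fromEdgeSet (F : Set (Sym2 V))).IsAcyclic) :
    F.card < Fintype.card V := by
  classical
  obtain ⟨T, hle, -, hT⟩ := SimpleGraph.connected_top.exists_isTree_le_of_le_of_isAcyclic
    le_top hF
  rw [← hT.card_edgeFinset, Nat.lt_succ_iff]
  refine Finset.card_le_card fun e he ↦ ?_
  rw [SimpleGraph.mem_edgeFinset]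
  refine SimpleGraph.edgeSet_mono hle ?_
  rw [SimpleGraph.edgeSet_fromEdgeSet]
  exact ⟨he, by simpa using hd e he⟩

/-- Kruskal's algorithm: a forest in which the ends of every edge `e` are joined by a path that
uses no edge heavier than `e`. -/
lemma exists_bottleneckForest [DecidableEq V] [Nonempty V] (w : Sym2 V → ℝ≥0)
    (E : Finset (Sym2 V)) :
    ∃ F ⊆ E, F.card < Fintype.card V ∧ ∀ u v, s(u, v) ∈ E →
      (SimpleGraph.fromEdgeSet {f | f ∈ F ∧ w f ≤ w s(u, v)}).Reachable u v := by
  suffices h : ∃ F ⊆ E, (∀ e ∈ F, ¬ e.IsDiag) ∧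
      (SimpleGraph.fromEdgeSet (F : Set (Sym2 V))).IsAcyclic ∧ ∀ u v, s(u, v) ∈ E →
      (SimpleGraph.fromEdgeSet {f | f ∈ F ∧ w f ≤ w s(u, v)}).Reachable u v by
    obtain ⟨F, h1, h2, h3, h4⟩ := h
    exact ⟨F, h1, card_lt_of_isAcyclic h2 h3, h4⟩
  induction E using Finset.induction_on_max_value w with
  | empty => exact ⟨∅, by simp⟩
  | insert e E he hmax ih =>
    obtain ⟨F, hFE, hd, hac, hr⟩ := ih
    obtain ⟨x, y⟩ := e
    change s(x, y) ∉ E at he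
    change ∀ f ∈ E, w f ≤ w s(x, y) at hmax
    by_cases hxy : (SimpleGraph.fromEdgeSet (F : Set (Sym2 V))).Reachable x y
    · refine ⟨F, hFE.trans (Finset.subset_insert _ _), hd, hac, fun u v huv ↦ ?_⟩
      rcases Finset.mem_insert.1 huv with huv | huv
      · have heq : {f | f ∈ F ∧ w f ≤ w s(x, y)} = (F : Set (Sym2 V)) := by
          ext f; simpa using fun hf ↦ hmax f (hFE hf)
        change s(u, v) = s(x, y) at huv
        rw [huv, heq]
        rcases Sym2.eq_iff.1 huv with ⟨rfl, rfl⟩ | ⟨rfl, rfl⟩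
        exacts [hxy, hxy.symm]
      · exact hr u v huv
    · have hne : x ≠ y := by rintro rfl; exact hxy (SimpleGraph.Reachable.refl _)
      refine ⟨insert s(x, y) F, Finset.insert_subset_insert _ hFE, ?_, ?_, fun u v huv ↦ ?_⟩
      · intro f hf
        rcases Finset.mem_insert.1 hf with rfl | hf
        · simpa using hne
        · exact hd f hf
      · have : SimpleGraph.fromEdgeSet ((insert s(x, y) F : Finset (Sym2 V)) : Set (Sym2 V)) =
            SimpleGraph.fromEdgeSet (F : Set (Sym2 V)) ⊔ SimpleGraph.edge x y := by
          rw [SimpleGraph.edge, ← SimpleGraph.fromEdgeSet_union, Finset.coe_insert,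
            Set.union_singleton]
        rw [this]
        exact hac.sup_edge_of_not_reachable hxy
      · rcases Finset.mem_insert.1 huv with huv | huv
        · change s(u, v) = s(x, y) at huv
          refine SimpleGraph.Adj.reachable ?_
          rw [SimpleGraph.fromEdgeSet_adj]
          refine ⟨⟨by rw [huv]; simp, le_rfl⟩, ?_⟩
          rcases Sym2.eq_iff.1 huv with ⟨rfl, rfl⟩ | ⟨rfl, rfl⟩
          exacts [hne, hne.symm]
        · refine (hr u v huv).mono (SimpleGraph.fromEdgeSet_mono ?_)
          rintro f ⟨h1, h2⟩
          exact ⟨Finset.mem_insert_of_mem h1, h2⟩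

end Trees

/-! ### Graphs without short cycles are sparse -/

section Girth

variable {V : Type*} {Γ : SimpleGraph V} {k : ℕ}

/-- In a graph without cycles of length at most `2 * k`, a vertex has at most one neighbour that
is not farther than itself from a given vertex at distance less than `k` from these neighbours. -/
lemma eq_of_adj_of_dist_le (hg : ∀ a (c : Γ.Walk a a), c.IsCycle → 2 * k < c.length)
    {v x y z : V} (hy : Γ.Adj y x) (hz : Γ.Adj z x) (hv : Γ.Reachable v x)
    (hyx : Γ.dist v y ≤ Γ.dist v x) (hzx : Γ.dist v z ≤ Γ.dist v x)
    (hyk : Γ.dist v y < k) (hzk : Γ.dist v z < k) : y = z := by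
  classical
  have key : ∀ y, Γ.Adj y x → Γ.dist v y ≤ Γ.dist v x →
      ∃ p : Γ.Walk v x, p.IsPath ∧ p.length = Γ.dist v y + 1 ∧ p.penultimate = y := by
    intro y hy hyx
    obtain ⟨p, hp, hpl⟩ := (hv.trans hy.symm.reachable).exists_path_of_dist
    refine ⟨p.concat hy, hp.concat ?_ hy, by simp [hpl], by simp⟩
    intro hx
    have h1 := SimpleGraph.Walk.length_takeUntil_lt_length hx hy.ne'
    have h2 := SimpleGraph.dist_le (p.takeUntil x hx)
    omega
  obtain ⟨p, hp, hpl, hpp⟩ := key y hy hyx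
  obtain ⟨q, hq, hql, hqp⟩ := key z hz hzx
  by_contra hne
  have hpq : p ≠ q := by rintro rfl; exact hne (hpp.symm.trans hqp)
  obtain ⟨u, -, -, c, hc, hcl⟩ := hp.exists_isCycle_length_le_add_of_ne hq hpq
  have := hg _ c hc
  omega

variable [Fintype V]

open Classical in
/-- The edges that touch the ball of radius `r < k` are at most as many as the vertices of the ball
of radius `r + 1`: each of them is the only one that leads to its far end. -/
lemma card_edges_touching_ball_le
    (hg : ∀ a (c : Γ.Walk a a), c.IsCycle → 2 * k < c.length) (v : V) {r : ℕ} (hr : r < k) :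
    Finset.card {e : Sym2 V | e ∈ Γ.edgeSet ∧ ∃ x ∈ e, Γ.Reachable v x ∧ Γ.dist v x ≤ r} ≤
      Finset.card {x : V | Γ.Reachable v x ∧ Γ.dist v x ≤ r + 1} := by
  have hex : ∀ e : Sym2 V, (e ∈ Γ.edgeSet ∧ ∃ x ∈ e, Γ.Reachable v x ∧ Γ.dist v x ≤ r) →
      ∃ x y, e = s(y, x) ∧ Γ.Adj y x ∧ Γ.Reachable v x ∧ Γ.dist v y ≤ Γ.dist v x ∧
        Γ.dist v y ≤ r ∧ Γ.dist v x ≤ r + 1 := by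
    rintro e ⟨he, x, hx, hvx, hxr⟩
    obtain ⟨y, rfl⟩ := Sym2.mem_iff_exists.1 hx
    have hxy : Γ.Adj x y := he
    have hvy : Γ.Reachable v y := hvx.trans hxy.reachable
    have hle : Γ.dist v y ≤ Γ.dist v x + 1 := by
      have := hvx.dist_triangle_left y
      rwa [SimpleGraph.dist_eq_one_iff_adj.2 hxy] at this
    rcases le_total (Γ.dist v x) (Γ.dist v y) with h | h
    · exact ⟨y, x, rfl, hxy, hvy, h, hxr, by omega⟩
    · exact ⟨x, y, Sym2.eq_swap, hxy.symm, hvx, h, by omega, by omega⟩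
  have : Nonempty V := ⟨v⟩
  choose! f g hf using hex
  refine Finset.card_le_card_of_injOn f (fun e he ↦ ?_) fun e he e' he' h ↦ ?_
  · obtain ⟨-, -, h1, -, -, h2⟩ := hf e (by simpa using he)
    simpa using ⟨h1, h2⟩
  · obtain ⟨h1, h2, h3, h4, h5, -⟩ := hf e (by simpa using he)
    obtain ⟨h1', h2', h3', h4', h5', -⟩ := hf e' (by simpa using he')
    rw [← h] at h1' h2' h3' h4'
    rw [h1, h1', eq_of_adj_of_dist_le hg h2 h2' h3 h4 h4' (by omega) (by omega)]

open Classical in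
/-- A graph whose edges live on at most `D ^ k` vertices and which has no cycle of length at most
`2 * k` has at most `D` edges per vertex.  A ball that grows by a factor of at most `D` in the next
step is removed together with all edges that touch it. -/
lemma card_edges_le_of_girth (hk : 1 ≤ k) {D : ℝ} (hD : 0 ≤ D)
    (hg : ∀ a (c : Γ.Walk a a), c.IsCycle → 2 * k < c.length) (A : Finset V)
    (hA : ∀ x y, Γ.Adj x y → x ∈ A) (hcard : (A.card : ℝ) ≤ D ^ k) :
    (Finset.card {e : Sym2 V | e ∈ Γ.edgeSet} : ℝ) ≤ D * A.card := by
  induction hn : A.card using Nat.strong_induction_on generalizing A Γ with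
  | _ m ih =>
    rcases A.eq_empty_or_nonempty with rfl | ⟨v, hv⟩
    · have : ({e : Sym2 V | e ∈ Γ.edgeSet} : Finset (Sym2 V)) = ∅ := by
        ext e
        induction e with | _ x y => simpa using fun h ↦ by simpa using hA x y h
      rw [this]
      simp only [Finset.card_empty] at hn ⊢
      simp [← hn]
    let B : ℕ → Finset V := fun r ↦ {x | Γ.Reachable v x ∧ Γ.dist v x ≤ r}
    have hBA : ∀ r, B r ⊆ A := by
      intro r x hx
      obtain ⟨p⟩ : Γ.Reachable v x := by simp [B] at hx; exact hx.1
      cases hq : p.reverse with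
      | nil => exact hv
      | cons h _ => exact hA _ _ h
    obtain ⟨r, hr, hgrow⟩ : ∃ r < k, ((B (r + 1)).card : ℝ) ≤ D * (B r).card := by
      by_contra! hcon
      have hpow : ∀ r ≤ k, D ^ r ≤ (B r).card := by
        intro r
        induction r with
        | zero =>
          intro _
          have : 0 < (B 0).card := Finset.card_pos.2 ⟨v, by simp [B]⟩
          simpa using Nat.one_le_iff_ne_zero.2 this.ne'
        | succ r ihr =>
          intro hr
          calc D ^ (r + 1) = D * D ^ r := pow_succ' ..
            _ ≤ D * (B r).card := by gcongr; exact ihr (by omega)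
            _ ≤ _ := (hcon r hr).le
      obtain ⟨j, rfl⟩ : ∃ j, k = j + 1 := ⟨k - 1, by omega⟩
      have h1 := hcon j (by omega)
      have h2 : D ^ (j + 1) ≤ D * (B j).card := by
        rw [pow_succ']; gcongr; exact hpow j (by omega)
      have h3 : ((B (j + 1)).card : ℝ) ≤ A.card := by exact_mod_cast Finset.card_le_card (hBA _)
      linarith
    let Γ' : SimpleGraph V :=
      { Adj := fun x y ↦ Γ.Adj x y ∧ x ∉ B r ∧ y ∉ B r
        symm := ⟨fun x y h ↦ ⟨h.1.symm, h.2.2, h.2.1⟩⟩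
        loopless := ⟨fun x h ↦ h.1.ne rfl⟩ }
    have hle : Γ' ≤ Γ := fun x y h ↦ h.1
    have hvB : v ∈ B r := by simp [B]
    have hsub : (A \ B r).card + (B r).card = A.card := Finset.card_sdiff_add_card_eq_card (hBA r)
    have hpos : 0 < (B r).card := Finset.card_pos.2 ⟨v, hvB⟩
    have hsubR : ((A \ B r).card : ℝ) + (B r).card = A.card := by exact_mod_cast hsub
    have ih' := ih (A \ B r).card (by omega) (Γ := Γ') (fun a c hc ↦ by
        have := hg a (c.mapLe hle) (hc.mapLe hle)
        simpa using this) (A \ B r) (fun x y h ↦ by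
          simp only [Finset.mem_sdiff]; exact ⟨hA x y h.1, h.2.1⟩)
        (le_trans (by linarith [(Nat.cast_nonneg (B r).card : (0 : ℝ) ≤ _)]) hcard) rfl
    have hunion : ({e : Sym2 V | e ∈ Γ.edgeSet} : Finset (Sym2 V)) ⊆
        ({e : Sym2 V | e ∈ Γ.edgeSet ∧ ∃ x ∈ e, Γ.Reachable v x ∧ Γ.dist v x ≤ r} :
          Finset (Sym2 V)) ∪ ({e : Sym2 V | e ∈ Γ'.edgeSet} : Finset (Sym2 V)) := by
      intro e he
      induction e with | _ x y =>
      simp only [Finset.mem_filter, Finset.mem_univ, true_and, Finset.mem_union,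
        SimpleGraph.mem_edgeSet] at he ⊢
      by_cases hx : x ∈ B r
      · exact Or.inl ⟨he, x, by simp, by simpa [B] using hx⟩
      by_cases hy : y ∈ B r
      · exact Or.inl ⟨he, y, by simp, by simpa [B] using hy⟩
      exact Or.inr ⟨he, hx, hy⟩
    have h1 := (Finset.card_le_card hunion).trans (Finset.card_union_le _ _)
    have h2 := card_edges_touching_ball_le hg v hr
    have h3 : (Finset.card {e : Sym2 V | e ∈ Γ.edgeSet} : ℝ) ≤
        (B (r + 1)).card + Finset.card {e : Sym2 V | e ∈ Γ'.edgeSet} := by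
      exact_mod_cast h1.trans (Nat.add_le_add_right h2 _)
    rw [hn] at hsubR
    calc _ ≤ _ := h3
      _ ≤ D * (B r).card + D * (A \ B r).card :=
          add_le_add hgrow (le_trans (le_of_eq (by congr!)) ih')
      _ = D * m := by rw [← hsubR]; ring

lemma ncard_edgeSet_le_of_girth (hk : 1 ≤ k) {D : ℝ} (hD : 0 ≤ D)
    (hg : ∀ a (c : Γ.Walk a a), c.IsCycle → 2 * k < c.length) (A : Finset V)
    (hA : ∀ x y, Γ.Adj x y → x ∈ A) (hcard : (A.card : ℝ) ≤ D ^ k) :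
    (Γ.edgeSet.ncard : ℝ) ≤ D * A.card := by
  classical
  refine le_trans (le_of_eq ?_) (card_edges_le_of_girth hk hD hg A hA hcard)
  rw [← Set.ncard_coe_finset]
  simp

end Girth

/-! ### Potentials and the edges they violate -/

section Halving

/-- The coordinates of a list, padded with `none` or truncated to length `N`. -/
def padded {α : Type*} (N : ℕ) (l : List α) : Fin N → Option α := fun i ↦ l[(i : ℕ)]?

lemma padded_inj {α : Type*} {N : ℕ} {l l' : List α} (hl : l.length ≤ N) (hl' : l'.length ≤ N)
    (h : padded N l = padded N l') : l = l' := by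
  refine List.ext_getElem? fun i ↦ ?_
  by_cases hi : i < N
  · exact congrFun h ⟨i, hi⟩
  · rw [List.getElem?_eq_none (by omega), List.getElem?_eq_none (by omega)]

lemma card_subsets_le {α : Type*} [DecidableEq α] (D : Finset α) (n : ℕ)
    (𝒮 : Finset (Finset α)) (h𝒮 : ∀ s ∈ 𝒮, s ⊆ D ∧ s.card ≤ n) :
    𝒮.card ≤ (D.card + 1) ^ n := by
  have : (Fintype.piFinset fun _ : Fin n ↦ Finset.insertNone D).card = (D.card + 1) ^ n := by
    simp
  rw [← this]
  refine Finset.card_le_card_of_injOn (fun s ↦ padded n s.toList) (fun s hs ↦ ?_)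
    fun s hs s' hs' h ↦ ?_
  · simp only [Finset.mem_coe, Fintype.mem_piFinset, Finset.mem_insertNone, padded]
    intro i a ha
    exact (h𝒮 s hs).1 (Finset.mem_toList.1 (List.mem_of_getElem? ha))
  · have := padded_inj (by simpa using (h𝒮 s hs).2) (by simpa using (h𝒮 s' hs').2) h
    rw [← Finset.toList_toFinset s, this, Finset.toList_toFinset]

variable {n : ℕ}

/-- The potential `φ` drops along the item, from the smaller to the larger end of its edge, by more
than the weight of the item. -/
def Violates (φ : Fin n → ℝ) (x : Item n) : Prop := (x.2 : ℝ) < φ x.1.inf - φ x.1.sup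

open Classical in
/-- The number of items of a list, with multiplicity, that a potential violates. -/
noncomputable def violCount (φ : Fin n → ℝ) (l : List (Item n)) : ℕ :=
  l.countP fun x ↦ decide (Violates φ x)

@[simp] lemma violCount_nil (φ : Fin n → ℝ) : violCount φ [] = 0 := rfl

lemma violCount_append (φ : Fin n → ℝ) (l l' : List (Item n)) :
    violCount φ (l ++ l') = violCount φ l + violCount φ l' := by
  simp [violCount]

lemma violCount_eq_zero {φ : Fin n → ℝ} {l : List (Item n)} (h : ∀ x ∈ l, ¬ Violates φ x) :
    violCount φ l = 0 := by
  simpa [violCount, List.countP_eq_zero] using h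

open Classical in
/-- The traces on `D` of the sets of violated items. -/
noncomputable def violationRanges (D : Finset (Item n)) : Finset (Finset (Item n)) :=
  {A ∈ D.powerset | ∃ φ : Fin n → ℝ, A = {x ∈ D | Violates φ x}}

open Classical in
/-- The sets of violated items have Vapnik-Chervonenkis dimension at most `n`.  The functionals
`φ ↦ φ u - φ v` of more than `n` items are linearly dependent; a potential that violates exactly
the items with a positive coefficient, and one that violates exactly those with a negative
coefficient, contradict each other. -/
lemma card_le_of_shatters {D s : Finset (Item n)} (hs : (violationRanges D).Shatters s) :
    s.card ≤ n := by
  by_contra! hcard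
  let f : s → Module.Dual ℝ (Fin n → ℝ) := fun x ↦
    (LinearMap.proj (x : Item n).1.inf : (Fin n → ℝ) →ₗ[ℝ] ℝ) - LinearMap.proj (x : Item n).1.sup
  have hdep : ¬ LinearIndependent ℝ f := fun h ↦ by
    have := h.fintype_card_le_finrank
    rw [Subspace.dual_finrank_eq] at this
    simp at this
    omega
  obtain ⟨c, hc, i, hi⟩ := Fintype.not_linearIndependent_iff.1 hdep
  have hsum : ∀ φ : Fin n → ℝ,
      ∑ x : s, c x * (φ (x : Item n).1.inf - φ (x : Item n).1.sup) = 0 := by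
    intro φ
    have := congrArg (fun F : Module.Dual ℝ (Fin n → ℝ) ↦ F φ) hc
    simpa [f] using this
  have hpat : ∀ P : s → Prop, ∃ φ : Fin n → ℝ, ∀ x : s, Violates φ x ↔ P x := by
    intro P
    obtain ⟨u, hu, hsu⟩ := @hs (s.attach.filter P |>.image Subtype.val) (by
      intro x; simp only [Finset.mem_image]; rintro ⟨y, -, rfl⟩; exact y.2)
    have hsD : s ⊆ D := by
      obtain ⟨u, hu, hsu⟩ := hs.exists_superset
      exact hsu.trans (Finset.mem_powerset.1 (Finset.mem_filter.1 hu).1)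
    obtain ⟨-, φ, rfl⟩ := Finset.mem_filter.1 hu
    refine ⟨φ, fun x ↦ ?_⟩
    have := congrArg ((x : Item n) ∈ ·) hsu
    simpa [hsD x.2] using this
  obtain ⟨φ, hφ⟩ := hpat fun x ↦ 0 < c x
  obtain ⟨ψ, hψ⟩ := hpat fun x ↦ c x < 0
  have h1 : ∀ x : s, c x * (x : Item n).2 ≤ c x * (φ (x : Item n).1.inf - φ (x : Item n).1.sup) ∧
      (0 < c x → c x * (x : Item n).2 < c x * (φ (x : Item n).1.inf - φ (x : Item n).1.sup)) := by
    intro x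
    by_cases hx : 0 < c x
    · have := mul_lt_mul_of_pos_left ((hφ x).2 hx) hx
      exact ⟨this.le, fun _ ↦ this⟩
    · refine ⟨mul_le_mul_of_nonpos_left (not_lt.1 fun h ↦ hx ((hφ x).1 h)) (not_lt.1 hx),
        fun h ↦ absurd h hx⟩
  have h2 : ∀ x : s, c x * (ψ (x : Item n).1.inf - ψ (x : Item n).1.sup) ≤ c x * (x : Item n).2 ∧
      (c x < 0 → c x * (ψ (x : Item n).1.inf - ψ (x : Item n).1.sup) < c x * (x : Item n).2) := by
    intro x
    by_cases hx : c x < 0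
    · have := mul_lt_mul_of_neg_left ((hψ x).2 hx) hx
      exact ⟨this.le, fun _ ↦ this⟩
    · refine ⟨mul_le_mul_of_nonneg_left (not_lt.1 fun h ↦ hx ((hψ x).1 h)) (not_lt.1 hx),
        fun h ↦ absurd h hx⟩
  have h3 : ∑ x : s, c x * ((x : Item n).2 : ℝ) ≤ 0 := by
    rw [← hsum φ]; exact Finset.sum_le_sum fun x _ ↦ (h1 x).1
  have h4 : 0 ≤ ∑ x : s, c x * ((x : Item n).2 : ℝ) := by
    rw [← hsum ψ]; exact Finset.sum_le_sum fun x _ ↦ (h2 x).1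
  rcases lt_or_gt_of_ne hi with hi | hi
  · have : ∑ x : s, c x * (ψ (x : Item n).1.inf - ψ (x : Item n).1.sup) <
        ∑ x : s, c x * ((x : Item n).2 : ℝ) :=
      Finset.sum_lt_sum (fun x _ ↦ (h2 x).1) ⟨i, Finset.mem_univ _, (h2 i).2 hi⟩
    rw [hsum ψ] at this
    linarith
  · have : ∑ x : s, c x * ((x : Item n).2 : ℝ) <
        ∑ x : s, c x * (φ (x : Item n).1.inf - φ (x : Item n).1.sup) :=
      Finset.sum_lt_sum (fun x _ ↦ (h1 x).1) ⟨i, Finset.mem_univ _, (h1 i).2 hi⟩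
    rw [hsum φ] at this
    linarith

open Classical in
lemma card_violationRanges_le (D : Finset (Item n)) :
    (violationRanges D).card ≤ (D.card + 1) ^ n := by
  refine (Finset.card_le_card_shatterer _).trans (card_subsets_le D n _ fun s hs ↦ ?_)
  rw [Finset.mem_shatterer] at hs
  refine ⟨?_, card_le_of_shatters hs⟩
  obtain ⟨u, hu, hsu⟩ := hs.exists_superset
  exact hsu.trans (Finset.mem_powerset.1 (Finset.mem_filter.1 hu).1)

/-! ### Halving a list of items -/

/-- One item is kept of each of `N` pairs.  The choices are made one after the other so that the
total potential of finitely many ranges never grows; the average over both choices of a pair does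
not exceed the present value since `x * (1 + y) ≤ 2` and `x ^ 2 * y ≤ 1`. -/
lemma exists_half_of_ranges {α : Type*} [DecidableEq α] (I : Finset (Finset α)) {x y : ℝ}
    (hx : 0 ≤ x) (hy : 0 ≤ y) (h1 : x * (1 + y) ≤ 2) (h2 : x ^ 2 * y ≤ 1) (N : ℕ) (l : List α)
    (hl : l.length = 2 * N) :
    ∃ l' : List α, l'.length = N ∧ l' ⊆ l ∧
      ∑ A ∈ I, x ^ l.countP (· ∈ A) * y ^ l'.countP (· ∈ A) ≤ I.card := by
  induction N generalizing l with
  | zero =>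
    have : l = [] := List.length_eq_zero_iff.1 (by simpa using hl)
    subst this
    exact ⟨[], by simp⟩
  | succ N ih =>
    match l, hl with
    | a :: b :: t, hl =>
      obtain ⟨t', ht', hsub, hsum⟩ := ih t (by simp at hl; omega)
      set S : α → ℝ := fun c ↦ ∑ A ∈ I, x ^ (a :: b :: t).countP (· ∈ A) *
        y ^ (c :: t').countP (· ∈ A) with hS
      have havg : S a + S b ≤ 2 * I.card := by
        refine le_trans ?_ (mul_le_mul_of_nonneg_left hsum zero_le_two)
        rw [hS, ← Finset.sum_add_distrib, Finset.mul_sum]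
        refine Finset.sum_le_sum fun A _ ↦ ?_
        have hpos : 0 ≤ x ^ t.countP (· ∈ A) * y ^ t'.countP (· ∈ A) := by positivity
        by_cases ha : a ∈ A <;> by_cases hb : b ∈ A <;>
          simp only [List.countP_cons, ha, hb, decide_true, decide_false, if_true, if_false,
            Bool.false_eq_true, add_zero, pow_succ]
        · nlinarith
        · nlinarith
        · nlinarith
        · linarith
      have hmem : ∀ c ∈ [a, b], c :: t' ⊆ a :: b :: t := by
        intro c hc d hd
        rcases List.mem_cons.1 hd with rfl | hd
        · simp at hc ⊢; tauto
        · simp [hsub hd]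
      by_cases hab : S a ≤ S b
      · exact ⟨a :: t', by simp [ht'], hmem a (by simp), by simp only [hS] at hab havg ⊢; linarith⟩
      · exact ⟨b :: t', by simp [ht'], hmem b (by simp), by
          simp only [hS, not_le] at hab havg ⊢; linarith⟩

/-- `l'` is a half of `l` in which every potential that violates few items of `l'` violates few
items of `l`: up to the factor `2 * (1 + 2 * η)` and the additive term `c`. -/
def IsHalf (η c : ℝ) (l l' : List (Item n)) : Prop :=
  2 * l'.length = l.length ∧ l' ⊆ l ∧
    ∀ φ, (violCount φ l : ℝ) ≤ 2 * (1 + 2 * η) * violCount φ l' + c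

/-- Halving with `x = 1 + η` and `y = (1 - η) / (1 + η)`: there are at most `M ^ n` ranges, and no
term of the final potential exceeds their number. -/
lemma exists_isHalf {η : ℝ} (hη : 0 < η) (hη' : η ≤ 1 / 2) (D : Finset (Item n)) {M : ℕ}
    (hM : D.card + 1 ≤ M) {N : ℕ} {l : List (Item n)} (hl : l.length = 2 * N)
    (hlD : ∀ x ∈ l, x ∈ D) :
    ∃ l', IsHalf η (2 * n * Real.log M / η) l l' := by
  classical
  have hy0 : 0 < (1 - η) / (1 + η) := by apply div_pos <;> linarith
  obtain ⟨l', hl', hsub, hsum⟩ := exists_half_of_ranges (violationRanges D)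
    (x := 1 + η) (y := (1 - η) / (1 + η)) (by linarith) hy0.le
    (by field_simp; linarith) (by field_simp; nlinarith) N l hl
  refine ⟨l', by omega, hsub, fun φ ↦ ?_⟩
  set A : Finset (Item n) := {x ∈ D | Violates φ x} with hA
  have hAmem : A ∈ violationRanges D := by
    simp only [violationRanges, Finset.mem_filter, Finset.mem_powerset]
    exact ⟨Finset.filter_subset _ _, φ, rfl⟩
  have hcount : ∀ t : List (Item n), t ⊆ l → t.countP (· ∈ A) = violCount φ t := by
    intro t ht
    refine List.countP_congr fun x hx ↦ ?_
    simp [hA, hlD x (ht hx)]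
  have hterm := (Finset.single_le_sum (f := fun A ↦ (1 + η) ^ l.countP (· ∈ A) *
    ((1 - η) / (1 + η)) ^ l'.countP (· ∈ A)) (fun A _ ↦ by positivity) hAmem).trans hsum
  simp only at hterm
  rw [hcount l (List.Subset.refl _), hcount l' hsub] at hterm
  have hcard : ((violationRanges D).card : ℝ) ≤ (M : ℝ) ^ n := by
    exact_mod_cast (card_violationRanges_le D).trans (Nat.pow_le_pow_left hM n)
  have hM0 : (1 : ℝ) ≤ M := by exact_mod_cast le_trans (by omega) hM
  have hlog := Real.log_le_log (by positivity) (hterm.trans hcard)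
  rw [Real.log_mul (by positivity) (by positivity), Real.log_pow, Real.log_pow, Real.log_pow,
    Real.log_div (by linarith) (by linarith)] at hlog
  set u := Real.log (1 + η)
  set a : ℝ := (violCount φ l : ℝ)
  set b : ℝ := (violCount φ l' : ℝ)
  have hb : 0 ≤ b := Nat.cast_nonneg _
  have hu : η / (1 + η) ≤ u := by
    have := Real.one_sub_inv_le_log_of_pos (show 0 < 1 + η by linarith)
    calc η / (1 + η) = 1 - (1 + η)⁻¹ := by field_simp; ring
      _ ≤ u := this
  have hu0 : 0 < u := lt_of_lt_of_le (by positivity) hu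
  have hm : -(1 + 4 * η) * u ≤ Real.log (1 - η) := by
    have h1 := Real.one_sub_inv_le_log_of_pos (show 0 < 1 - η by linarith)
    have h2 : -(1 + 4 * η) * u ≤ -(1 + 4 * η) * (η / (1 + η)) :=
      mul_le_mul_of_nonpos_left hu (by linarith)
    refine h2.trans (le_trans ?_ h1)
    have h3 : 0 < 1 - η := by linarith
    rw [← sub_nonneg]
    have : 1 - (1 - η)⁻¹ - -(1 + 4 * η) * (η / (1 + η)) =
        2 * η ^ 2 * (1 - 2 * η) / ((1 - η) * (1 + η)) := by
      field_simp; ring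
    rw [this]
    have : 0 ≤ 1 - 2 * η := by linarith
    positivity
  have hlM : 0 ≤ n * Real.log M := mul_nonneg (Nat.cast_nonneg _) (Real.log_nonneg hM0)
  have hbound : a * u ≤ (2 * (1 + 2 * η) * b) * u + n * Real.log M := by
    have := mul_le_mul_of_nonneg_left hm hb
    nlinarith
  have hc : n * Real.log M ≤ 2 * n * Real.log M / η * u := by
    have h1 : 1 ≤ 2 / η * u := by
      have : 1 ≤ 2 / η * (η / (1 + η)) := by
        rw [div_mul_div_comm, le_div_iff₀ (by positivity)]; nlinarith
      exact this.trans (by gcongr)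
    calc n * Real.log M = n * Real.log M * 1 := (mul_one _).symm
      _ ≤ n * Real.log M * (2 / η * u) := by gcongr
      _ = _ := by ring
  refine le_of_mul_le_mul_right ?_ hu0
  linarith

end Halving

/-! ### Merge and reduce -/

section MergeReduce

variable {n : ℕ}

open Classical in
/-- A half of `l` in the sense of `IsHalf`, if there is one. -/
noncomputable def halve (η c : ℝ) (l : List (Item n)) : List (Item n) :=
  if h : ∃ l', IsHalf η c l l' then h.choose else []

lemma isHalf_halve {η c : ℝ} {l : List (Item n)} (h : ∃ l', IsHalf η c l l') :
    IsHalf η c l (halve η c l) := by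
  rw [halve, dif_pos h]
  exact h.choose_spec

/-- Adds a block to a binary counter whose digits are blocks: an empty digit takes the block, and a
full digit is merged with it, halved and carried on. -/
noncomputable def carry (η c : ℝ) : List (List (Item n)) → List (Item n) → List (List (Item n))
  | [], l => [l]
  | [] :: rest, l => l :: rest
  | (x :: b) :: rest, l => [] :: carry η c rest (halve η c ((x :: b) ++ l))

/-- Adds an item to the raw buffer, which goes into the binary counter once it holds `N` items. -/
noncomputable def feed (η c : ℝ) (N : ℕ) (S : List (Item n) × List (List (Item n))) (x : Item n) :
    List (Item n) × List (List (Item n)) :=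
  if (x :: S.1).length = N then ([], carry η c S.2 (x :: S.1)) else (x :: S.1, S.2)

/-- The error per item that accumulates in `j` rounds of halving. -/
noncomputable def errorRate (η c : ℝ) (N j : ℕ) : ℝ := j * (1 + 2 * η) ^ j * c / N

/-- The block `l` of `N` items stands for the `2 ^ j * N` items of `τ`. -/
structure Represents (η c : ℝ) (N j : ℕ) (l τ : List (Item n)) : Prop where
  length_left : l.length = N
  length_right : τ.length = 2 ^ j * N
  subset : l ⊆ τ
  violCount_le : ∀ φ, (violCount φ τ : ℝ) ≤
    (2 * (1 + 2 * η)) ^ j * violCount φ l + errorRate η c N j * τ.length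

/-- The digits from position `j` on of a binary counter stand for the items of `τ`.  The last digit
is never empty. -/
def CounterRepresents (η c : ℝ) (N : ℕ) : ℕ → List (List (Item n)) → List (Item n) → Prop
  | _, [], τ => τ = []
  | j, b :: rest, τ => (b = [] ∧ rest ≠ [] ∧ CounterRepresents η c N (j + 1) rest τ) ∨
      ∃ τ₁ τ₂, τ.Perm (τ₁ ++ τ₂) ∧ Represents η c N j b τ₁ ∧
        CounterRepresents η c N (j + 1) rest τ₂

variable {η c : ℝ} {N : ℕ}

lemma violCount_perm {φ : Fin n → ℝ} {l l' : List (Item n)} (h : l.Perm l') :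
    violCount φ l = violCount φ l' := h.countP_eq _

lemma CounterRepresents.perm {j : ℕ} {slots : List (List (Item n))} {τ τ' : List (Item n)}
    (h : CounterRepresents η c N j slots τ) (hp : τ'.Perm τ) :
    CounterRepresents η c N j slots τ' := by
  induction slots generalizing j τ τ' with
  | nil =>
    simp only [CounterRepresents] at h ⊢
    subst h
    exact hp.eq_nil
  | cons b rest ih =>
    simp only [CounterRepresents] at h ⊢
    rcases h with ⟨h1, h2, h3⟩ | ⟨τ₁, τ₂, h1, h2, h3⟩
    · exact Or.inl ⟨h1, h2, ih h3 hp⟩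
    · exact Or.inr ⟨τ₁, τ₂, hp.trans h1, h2, h3⟩

lemma Represents.merge (hη : 0 ≤ η) (hc : 0 ≤ c) (hN : 0 < N) {j : ℕ}
    {l₁ l₂ l τ₁ τ₂ : List (Item n)} (h₁ : Represents η c N j l₁ τ₁)
    (h₂ : Represents η c N j l₂ τ₂) (hl : IsHalf η c (l₁ ++ l₂) l) :
    Represents η c N (j + 1) l (τ₁ ++ τ₂) := by
  obtain ⟨hlen, hsub, hviol⟩ := hl
  have hlen' : (τ₁ ++ τ₂).length = 2 ^ (j + 1) * N := by
    rw [List.length_append, h₁.length_right, h₂.length_right]; ring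
  refine ⟨?_, hlen', ?_, fun φ ↦ ?_⟩
  · rw [List.length_append, h₁.length_left, h₂.length_left] at hlen; omega
  · refine fun x hx ↦ List.mem_append.2 ?_
    rcases List.mem_append.1 (hsub hx) with h | h
    exacts [Or.inl (h₁.subset h), Or.inr (h₂.subset h)]
  · have hA : (0 : ℝ) ≤ (2 * (1 + 2 * η)) ^ j := by positivity
    have e1 := h₁.violCount_le φ
    have e2 := h₂.violCount_le φ
    have e3 := mul_le_mul_of_nonneg_left (hviol φ) hA
    have hN' : (0 : ℝ) < N := by exact_mod_cast hN
    have hq : (1 + 2 * η) ^ j ≤ (1 + 2 * η) ^ (j + 1) :=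
      pow_le_pow_right₀ (by linarith) (Nat.le_succ j)
    -- the error added by one more round is spread over the `2 ^ (j + 1) * N` items
    have herr : (2 * (1 + 2 * η)) ^ j * c + errorRate η c N j * (τ₁ ++ τ₂).length ≤
        errorRate η c N (j + 1) * (τ₁ ++ τ₂).length := by
      rw [hlen']
      unfold errorRate
      push_cast
      have l1 : (j : ℝ) * (1 + 2 * η) ^ j * c / N * (2 ^ (j + 1) * N) =
          j * (1 + 2 * η) ^ j * c * 2 ^ (j + 1) := by field_simp
      have l2 : ((j : ℝ) + 1) * (1 + 2 * η) ^ (j + 1) * c / N * (2 ^ (j + 1) * N) =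
          (j + 1) * (1 + 2 * η) ^ (j + 1) * c * 2 ^ (j + 1) := by field_simp
      rw [l1, l2, mul_pow]
      have l3 : ((j : ℝ) + 1) * (1 + 2 * η) ^ j * c * 2 ^ (j + 1) ≤
          (j + 1) * (1 + 2 * η) ^ (j + 1) * c * 2 ^ (j + 1) := by gcongr
      refine le_trans ?_ l3
      have : (0 : ℝ) ≤ 2 ^ j * (1 + 2 * η) ^ j * c := by positivity
      rw [pow_succ 2 j]
      linarith
    rw [violCount_append] at e3 ⊢
    rw [List.length_append] at herr ⊢
    push_cast at e1 e2 e3 herr ⊢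
    rw [pow_succ]
    linarith

lemma carry_ne_nil (slots : List (List (Item n))) (l : List (Item n)) : carry η c slots l ≠ [] := by
  cases slots with
  | nil => simp [carry]
  | cons b rest => cases b <;> simp [carry]

lemma CounterRepresents.carry (hη : 0 ≤ η) (hc : 0 ≤ c) (hN : 0 < N) {D : Set (Item n)}
    (hD : ∀ l : List (Item n), l.length = 2 * N → (∀ x ∈ l, x ∈ D) → ∃ l', IsHalf η c l l')
    {j : ℕ} {slots : List (List (Item n))} {l τ τ₀ : List (Item n)}
    (h : CounterRepresents η c N j slots τ) (hl : Represents η c N j l τ₀)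
    (hτ : ∀ x ∈ τ, x ∈ D) (hτ₀ : ∀ x ∈ τ₀, x ∈ D) :
    CounterRepresents η c N j (carry η c slots l) (τ₀ ++ τ) := by
  induction slots generalizing j l τ τ₀ with
  | nil =>
    simp only [CounterRepresents] at h
    subst h
    exact Or.inr ⟨τ₀, [], List.Perm.refl _, hl, rfl⟩
  | cons b rest ih =>
    cases b with
    | nil =>
      rcases h with ⟨-, -, h⟩ | ⟨τ₁, τ₂, -, h2, -⟩
      · exact Or.inr ⟨τ₀, τ, List.Perm.refl _, hl, h⟩
      · have := h2.length_left
        simp at this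
        omega
    | cons x b =>
      rcases h with ⟨h, -⟩ | ⟨τ₁, τ₂, h1, h2, h3⟩
      · simp at h
      · have hτ₁ : ∀ x ∈ τ₁, x ∈ D := fun x hx ↦ hτ x (h1.mem_iff.2 (by simp [hx]))
        have hτ₂ : ∀ x ∈ τ₂, x ∈ D := fun x hx ↦ hτ x (h1.mem_iff.2 (by simp [hx]))
        have hhalf := isHalf_halve (hD ((x :: b) ++ l)
          (by rw [List.length_append, h2.length_left, hl.length_left]; omega) (fun y hy ↦ by
            rcases List.mem_append.1 hy with h | h
            exacts [hτ₁ y (h2.subset h), hτ₀ y (hl.subset h)]))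
        have := ih h3 (h2.merge hη hc hN hl hhalf) hτ₂ (fun y hy ↦ by
            rcases List.mem_append.1 hy with h | h
            exacts [hτ₁ y h, hτ₀ y h])
        refine Or.inl ⟨rfl, carry_ne_nil _ _, this.perm ?_⟩
        refine List.perm_append_comm.trans ((h1.append_right _).trans ?_)
        rw [List.append_assoc, List.append_assoc]
        exact List.Perm.append_left _ List.perm_append_comm

lemma CounterRepresents.length_le {j : ℕ} {slots : List (List (Item n))} {τ : List (Item n)}
    (h : CounterRepresents η c N j slots τ) (hs : slots ≠ []) :
    2 ^ (j + slots.length - 1) * N ≤ τ.length := by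
  induction slots generalizing j τ with
  | nil => exact absurd rfl hs
  | cons b rest ih =>
    have hle : ∀ {τ}, CounterRepresents η c N (j + 1) rest τ → rest ≠ [] →
        2 ^ (j + (b :: rest).length - 1) * N ≤ τ.length := by
      intro τ h hr
      have := ih h hr
      rwa [show j + 1 + rest.length - 1 = j + (b :: rest).length - 1 by
        simp only [List.length_cons]; omega] at this
    rcases h with ⟨-, hr, h⟩ | ⟨τ₁, τ₂, h1, h2, h3⟩
    · exact hle h hr
    · rw [h1.length_eq, List.length_append]
      by_cases hr : rest = []
      · subst hr
        rw [h2.length_right]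
        simp
      · exact (hle h3 hr).trans (Nat.le_add_left _ _)

lemma CounterRepresents.subset {j : ℕ} {slots : List (List (Item n))} {τ : List (Item n)}
    (h : CounterRepresents η c N j slots τ) : slots.flatten ⊆ τ := by
  induction slots generalizing j τ with
  | nil => simp
  | cons b rest ih =>
    rcases h with ⟨rfl, -, h⟩ | ⟨τ₁, τ₂, h1, h2, h3⟩
    · simpa using ih h
    · intro x hx
      rw [h1.mem_iff]
      rcases List.mem_append.1 (by simpa using hx : x ∈ b ++ rest.flatten) with hx | hx
      · exact List.mem_append_left _ (h2.subset hx)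
      · exact List.mem_append_right _ (ih h3 hx)

lemma CounterRepresents.length_of_mem {j : ℕ} {slots : List (List (Item n))} {τ : List (Item n)}
    (h : CounterRepresents η c N j slots τ) : ∀ b ∈ slots, b.length ≤ N := by
  induction slots generalizing j τ with
  | nil => simp
  | cons b rest ih =>
    rcases h with ⟨rfl, -, h⟩ | ⟨τ₁, τ₂, h1, h2, h3⟩
    · simpa using ih h
    · simpa [h2.length_left] using ih h3

lemma CounterRepresents.violCount_le {δ : ℝ} {j : ℕ} {slots : List (List (Item n))}
    {τ : List (Item n)} (h : CounterRepresents η c N j slots τ)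
    (hδ : ∀ i < j + slots.length, errorRate η c N i ≤ δ) {φ : Fin n → ℝ}
    (hφ : ∀ x ∈ slots.flatten, ¬ Violates φ x) : (violCount φ τ : ℝ) ≤ δ * τ.length := by
  induction slots generalizing j τ with
  | nil =>
    simp only [CounterRepresents] at h
    simp [h]
  | cons b rest ih =>
    have ih' := fun {τ} (h : CounterRepresents η c N (j + 1) rest τ) ↦ ih h
      (fun i hi ↦ hδ i (by simp only [List.length_cons]; omega)) (fun x hx ↦ hφ x (by simp [hx]))
    rcases h with ⟨rfl, -, h⟩ | ⟨τ₁, τ₂, h1, h2, h3⟩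
    · exact ih' h
    · rw [violCount_perm h1, violCount_append, h1.length_eq, List.length_append]
      have e1 := h2.violCount_le φ
      rw [violCount_eq_zero (l := b) fun x hx ↦ hφ x (by simp [hx])] at e1
      have e2 := mul_le_mul_of_nonneg_right (hδ j (by simp))
        (Nat.cast_nonneg τ₁.length : (0 : ℝ) ≤ _)
      have e3 := ih' h3
      push_cast at e1 ⊢
      linarith

/-- The raw buffer and the binary counter together stand for the items of `τ`. -/
def SummaryRepresents (η c : ℝ) (N : ℕ) (S : List (Item n) × List (List (Item n)))
    (τ : List (Item n)) : Prop :=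
  S.1.length < N ∧ ∃ τ', τ.Perm (S.1 ++ τ') ∧ CounterRepresents η c N 0 S.2 τ'

lemma SummaryRepresents.nil (hN : 0 < N) :
    SummaryRepresents η c N (([], []) : List (Item n) × List (List (Item n))) [] :=
  ⟨hN, [], List.Perm.refl _, rfl⟩

lemma SummaryRepresents.feed (hη : 0 ≤ η) (hc : 0 ≤ c) {D : Set (Item n)}
    (hD : ∀ l : List (Item n), l.length = 2 * N → (∀ x ∈ l, x ∈ D) → ∃ l', IsHalf η c l l')
    {S : List (Item n) × List (List (Item n))} {τ : List (Item n)} {x : Item n}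
    (h : SummaryRepresents η c N S τ) (hx : x ∈ D) (hτ : ∀ y ∈ τ, y ∈ D) :
    SummaryRepresents η c N (feed η c N S x) (x :: τ) := by
  obtain ⟨hlen, τ', hp, hcount⟩ := h
  have hN : 0 < N := by omega
  have hp' : (x :: τ).Perm ((x :: S.1) ++ τ') := hp.cons x
  unfold StreamSSSP.feed
  split_ifs with hfull
  · have hrep : Represents η c N 0 (x :: S.1) (x :: S.1) :=
      ⟨hfull, by simpa using hfull, List.Subset.refl _, by simp [errorRate]⟩
    refine ⟨hN, _, hp', hcount.carry hη hc hN hD hrep ?_ ?_⟩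
    · exact fun y hy ↦ hτ y (hp.mem_iff.2 (by simp [hy]))
    · intro y hy
      rcases List.mem_cons.1 hy with rfl | hy
      exacts [hx, hτ y (hp.mem_iff.2 (by simp [hy]))]
  · refine ⟨?_, τ', hp', hcount⟩
    simp only [List.length_cons] at hfull ⊢
    omega

lemma SummaryRepresents.feed_replicate (hη : 0 ≤ η) (hc : 0 ≤ c) {D : Set (Item n)}
    (hD : ∀ l : List (Item n), l.length = 2 * N → (∀ x ∈ l, x ∈ D) → ∃ l', IsHalf η c l l')
    {S : List (Item n) × List (List (Item n))} {τ : List (Item n)} {x : Item n}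
    (h : SummaryRepresents η c N S τ) (hx : x ∈ D) (hτ : ∀ y ∈ τ, y ∈ D) (m : ℕ) :
    SummaryRepresents η c N ((List.replicate m x).foldl (StreamSSSP.feed η c N) S)
      (List.replicate m x ++ τ) := by
  induction m generalizing S τ with
  | zero => simpa using h
  | succ m ih =>
    have := ih (h.feed hη hc hD hx hτ) (List.forall_mem_cons.2 ⟨hx, hτ⟩)
    rw [List.replicate_succ, List.foldl_cons]
    obtain ⟨h1, τ', h2, h3⟩ := this
    refine ⟨h1, τ', List.Perm.trans ?_ h2, h3⟩
    rw [← List.replicate_succ, List.replicate_succ']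
    simp

lemma SummaryRepresents.subset {S : List (Item n) × List (List (Item n))} {τ : List (Item n)}
    (h : SummaryRepresents η c N S τ) : S.1 ++ S.2.flatten ⊆ τ := by
  obtain ⟨-, τ', hp, hcount⟩ := h
  intro x hx
  rw [hp.mem_iff]
  rcases List.mem_append.1 hx with hx | hx
  exacts [List.mem_append_left _ hx, List.mem_append_right _ (hcount.subset hx)]

lemma SummaryRepresents.length_slots_le {S : List (Item n) × List (List (Item n))}
    {τ : List (Item n)} (h : SummaryRepresents η c N S τ) {L : ℕ} (hL : τ.length < 2 ^ L) :
    S.2.length ≤ L := by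
  obtain ⟨hlen, τ', hp, hcount⟩ := h
  by_contra! hlt
  have h1 := hcount.length_le (by rintro h; simp [h] at hlt)
  have h2 : 2 ^ L ≤ 2 ^ (0 + S.2.length - 1) := Nat.pow_le_pow_right (by norm_num) (by omega)
  have h3 : 2 ^ (0 + S.2.length - 1) ≤ 2 ^ (0 + S.2.length - 1) * N :=
    Nat.le_mul_of_pos_right _ (by omega)
  have h4 := hp.length_eq
  rw [List.length_append] at h4
  omega

/-- The net property: a potential that violates no stored item violates only a small part of all
the items. -/
lemma SummaryRepresents.violCount_le {S : List (Item n) × List (List (Item n))}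
    {τ : List (Item n)} (h : SummaryRepresents η c N S τ) {δ : ℝ}
    (hδ : ∀ i < S.2.length, errorRate η c N i ≤ δ) (hδ0 : 0 ≤ δ) {φ : Fin n → ℝ}
    (hφ : ∀ x ∈ S.1 ++ S.2.flatten, ¬ Violates φ x) : (violCount φ τ : ℝ) ≤ δ * τ.length := by
  obtain ⟨-, τ', hp, hcount⟩ := h
  rw [violCount_perm hp, violCount_append, hp.length_eq, List.length_append,
    violCount_eq_zero fun x hx ↦ hφ x (by simp [hx]), Nat.zero_add]
  refine (hcount.violCount_le (by simpa using hδ) fun x hx ↦ hφ x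
    (List.mem_append_right _ hx)).trans ?_
  gcongr
  simp

end MergeReduce

/-! ### Algorithms with structured memory -/

section Simulation

/-- The effect of a pass on a memory of arbitrary type. -/
def passOn {X I : Type*} (step : X → I → X) (endPass : X → X) (σ : List I) (x : X) : X :=
  endPass (σ.foldl step x)

/-- An algorithm on an arbitrary type of states can be run in `m` words of `b` bits, provided that
the states it actually meets are few enough to be coded by these words. -/
lemma exists_detAlgorithm {X Y : Type*} [Nonempty X] [Fintype Y] {n m b : ℕ} (good : Set X)
    (code : X → Y) (hcode : Set.InjOn code good) (hcard : Fintype.card Y ≤ (2 ^ b) ^ m)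
    (init : Fin n → X) (step : X → Item n → X) (endPass : X → X)
    (output : X → SimpleGraph (Fin n)) :
    ∃ A : DetAlgorithm n m b, ∀ (p : ℕ) (s : Fin n) (σ : List (Item n)),
      (∀ i < p, ∀ τ, τ <+: σ →
        τ.foldl step ((passOn step endPass σ)^[i] (init s)) ∈ good) →
      (passOn step endPass σ)^[p] (init s) ∈ good →
      A.run p s σ = output ((passOn step endPass σ)^[p] (init s)) := by
  obtain ⟨emb⟩ : Nonempty (Y ↪ Memory m b) :=
    Function.Embedding.nonempty_of_card_le (by simpa using hcard)
  let enc : X → Memory m b := emb ∘ code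
  have henc : Set.InjOn enc good := fun x hx y hy h ↦ hcode hx hy (emb.injective h)
  let dec : Memory m b → X := Function.invFunOn enc good
  have hdec : ∀ x ∈ good, dec (enc x) = x := henc.leftInvOn_invFunOn
  refine ⟨⟨fun s ↦ enc (init s), fun M x ↦ enc (step (dec M) x), fun M ↦ enc (endPass (dec M)),
    fun M ↦ output (dec M)⟩, fun p s σ hgood hlast ↦ ?_⟩
  have hfold : ∀ (x : X) (τ : List (Item n)), (∀ τ', τ' <+: τ → τ'.foldl step x ∈ good) →
      τ.foldl (fun M x ↦ enc (step (dec M) x)) (enc x) = enc (τ.foldl step x) := by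
    intro x τ
    induction τ using List.reverseRecOn with
    | nil => intro _; rfl
    | append_singleton τ a ih =>
      intro h
      have hτ := ih fun τ' h' ↦ h τ' (h'.trans (List.prefix_append _ _))
      rw [List.foldl_append, List.foldl_append, hτ]
      simp [hdec _ (h τ (List.prefix_append _ _))]
  have hpass : ∀ i ≤ p, (DetAlgorithm.pass ⟨fun s ↦ enc (init s), fun M x ↦ enc (step (dec M) x),
      fun M ↦ enc (endPass (dec M)), fun M ↦ output (dec M)⟩ σ)^[i] (enc (init s)) =
      enc ((passOn step endPass σ)^[i] (init s)) := by
    intro i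
    induction i with
    | zero => intro _; rfl
    | succ i ih =>
      intro hi
      rw [Function.iterate_succ_apply', Function.iterate_succ_apply', ih (by omega)]
      unfold DetAlgorithm.pass
      simp only
      rw [hfold _ _ (hgood i (by omega)), hdec _ (hgood i (by omega) σ (List.prefix_refl σ))]
      rfl
  unfold DetAlgorithm.run
  simp only
  rw [hpass p le_rfl, hdec _ hlast]

end Simulation

section State

variable {n : ℕ}

/-- The memory of the algorithm. -/
structure State (n : ℕ) where
  /-- the source vertex -/
  src : Fin n
  /-- the number of completed passes -/
  phase : ℕ
  /-- a bottleneck forest of the stream -/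
  forest : List (Item n)
  /-- a spanner of the stream, on top of the forest -/
  spanner : List (Item n)
  /-- the shortest path trees of the completed rounds -/
  trees : List (List (Item n))
  /-- the summary of the current pass: its raw buffer and its binary counter -/
  summary : List (Item n) × List (List (Item n))

/-- All items that are stored. -/
def State.items (S : State n) : List (Item n) :=
  S.forest ++ S.spanner ++ S.trees.flatten ++ (S.summary.1 ++ S.summary.2.flatten)

/-- The bounds on the sizes of the parts of the memory. -/
structure State.Fits (W : Finset ℝ≥0) (p a T N L : ℕ) (S : State n) : Prop where
  phase_le : S.phase ≤ p
  forest_le : S.forest.length ≤ n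
  spanner_le : S.spanner.length ≤ a
  trees_le : S.trees.length ≤ T
  trees_mem : ∀ l ∈ S.trees, l.length ≤ n
  raw_le : S.summary.1.length ≤ N
  slots_le : S.summary.2.length ≤ L
  slots_mem : ∀ l ∈ S.summary.2, l.length ≤ N
  weight_mem : ∀ x ∈ S.items, x.2 ∈ W

lemma map_injOn {α β : Type*} {f : α → β} {s : Set α} (hf : Set.InjOn f s) {l l' : List α}
    (hl : ∀ x ∈ l, x ∈ s) (hl' : ∀ x ∈ l', x ∈ s) (h : l.map f = l'.map f) : l = l' := by
  induction l generalizing l' with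
  | nil => simpa using h.symm
  | cons x l ih =>
    cases l' with
    | nil => simp at h
    | cons y l' =>
      simp only [List.map_cons, List.cons.injEq] at h
      rw [hf (hl x (by simp)) (hl' y (by simp)) h.1,
        ih (fun z hz ↦ hl z (by simp [hz])) (fun z hz ↦ hl' z (by simp [hz])) h.2]

lemma padded_map_injOn {α β : Type*} {f : α → β} {s : Set α} (hf : Set.InjOn f s) (N : ℕ) :
    Set.InjOn (fun l : List α ↦ padded N (l.map f)) {l | l.length ≤ N ∧ ∀ x ∈ l, x ∈ s} :=
  fun l hl l' hl' h ↦ map_injOn hf hl.2 hl'.2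
    (padded_inj (by simpa using hl.1) (by simpa using hl'.1) h)

/-- The number of words that suffice for states of the given sizes. -/
def wordCount (n p a T N L : ℕ) : ℕ :=
  1 + p + 4 * (n + a + N) + (4 * n + 1) * T + (4 * N + 1) * L

/-- The algorithm given by operations on states can be run in `wordCount n p a T N L` words. -/
lemma exists_detAlgorithm_of_state [NeZero n] {b : ℕ} {W : Finset ℝ≥0} {p a T N L : ℕ}
    (hb : 1 ≤ b) (hn : n ≤ 2 ^ b) (hW : W.card ≤ 2 ^ b) (init : Fin n → State n)
    (step : State n → Item n → State n) (endPass : State n → State n)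
    (output : State n → SimpleGraph (Fin n)) :
    ∃ A : DetAlgorithm n (wordCount n p a T N L) b, ∀ (p' : ℕ) (s : Fin n) (σ : List (Item n)),
      (∀ i < p', ∀ τ, τ <+: σ →
        (τ.foldl step ((passOn step endPass σ)^[i] (init s))).Fits W p a T N L) →
      ((passOn step endPass σ)^[p'] (init s)).Fits W p a T N L →
      A.run p' s σ = output ((passOn step endPass σ)^[p'] (init s)) := by
  have : Nonempty (State n) := ⟨⟨0, 0, [], [], [], [], []⟩⟩
  have hB : 1 < 2 ^ b := Nat.one_lt_two_pow (by omega)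
  have : Nonempty (Fin (2 ^ b)) := ⟨⟨0, by omega⟩⟩
  obtain ⟨ι, -, hι⟩ : ∃ ι : ℝ≥0 → Fin (2 ^ b), Set.MapsTo ι W (Set.univ : Set (Fin (2 ^ b))) ∧
      Set.InjOn ι W := by
    obtain ⟨e⟩ : Nonempty (W ↪ Fin (2 ^ b)) :=
      Function.Embedding.nonempty_of_card_le (by simpa using hW)
    classical
    refine ⟨fun x ↦ if h : x ∈ W then e ⟨x, h⟩ else Classical.arbitrary _, fun _ _ ↦ trivial,
      fun x hx y hy h ↦ ?_⟩
    have hx' : x ∈ W := hx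
    have hy' : y ∈ W := hy
    simpa [hx', hy'] using h
  let U := Sym2 (Fin n) × Fin (2 ^ b)
  let f : Item n → U := fun x ↦ (x.1, ι x.2)
  let s : Set (Item n) := {x | x.2 ∈ W}
  have hf : Set.InjOn f s := fun x hx y hy h ↦ by
    obtain ⟨h1, h2⟩ := Prod.mk.inj h
    exact Prod.ext h1 (hι hx hy h2)
  let Y := Fin n × Fin (p + 1) × (Fin n → Option U) × (Fin a → Option U) × (Fin N → Option U) ×
    (Fin T → Option (Fin n → Option U)) × (Fin L → Option (Fin N → Option U))
  let code : State n → Y := fun S ↦ (S.src, Fin.ofNat (p + 1) S.phase,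
    padded n (S.forest.map f), padded a (S.spanner.map f), padded N (S.summary.1.map f),
    padded T (S.trees.map fun l ↦ padded n (l.map f)),
    padded L (S.summary.2.map fun l ↦ padded N (l.map f)))
  refine exists_detAlgorithm {S : State n | S.Fits W p a T N L} code ?_ ?_ init step endPass output
  · intro S hS S' hS' h
    have hw : ∀ {S : State n}, S.Fits W p a T N L → ∀ x ∈ S.items, x ∈ s :=
      fun h x hx ↦ h.weight_mem x hx
    obtain ⟨src, phase, forest, spanner, trees, raw, slots⟩ := S
    obtain ⟨src', phase', forest', spanner', trees', raw', slots'⟩ := S'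
    have w1 := hw hS
    have w2 := hw hS'
    obtain ⟨b1, b2, b3, b4, b5, b6, b7, b8, -⟩ := hS
    obtain ⟨c1, c2, c3, c4, c5, c6, c7, c8, -⟩ := hS'
    simp only [State.items, List.mem_append] at *
    simp only [code, Y, Prod.mk.injEq] at h
    obtain ⟨h1, h2, h3, h4, h5, h6, h7⟩ := h
    have e2 : phase = phase' := by
      have := congrArg Fin.val h2
      simp only [Fin.ofNat] at this
      rwa [Nat.mod_eq_of_lt (by omega), Nat.mod_eq_of_lt (by omega)] at this
    have e3 : forest = forest' := padded_map_injOn hf n ⟨b2, fun x hx ↦ w1 x (by tauto)⟩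
      ⟨c2, fun x hx ↦ w2 x (by tauto)⟩ h3
    have e4 : spanner = spanner' := padded_map_injOn hf a ⟨b3, fun x hx ↦ w1 x (by tauto)⟩
      ⟨c3, fun x hx ↦ w2 x (by tauto)⟩ h4
    have e5 : raw = raw' := padded_map_injOn hf N ⟨b6, fun x hx ↦ w1 x (by tauto)⟩
      ⟨c6, fun x hx ↦ w2 x (by tauto)⟩ h5
    have e6 : trees = trees' := padded_map_injOn (padded_map_injOn hf n) T
      ⟨b4, fun l hl ↦ ⟨b5 l hl, fun x hx ↦ w1 x (Or.inl (Or.inr (List.mem_flatten.2 ⟨l, hl, hx⟩)))⟩⟩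
      ⟨c4, fun l hl ↦ ⟨c5 l hl, fun x hx ↦ w2 x (Or.inl (Or.inr (List.mem_flatten.2 ⟨l, hl, hx⟩)))⟩⟩
      h6
    have e7 : slots = slots' := padded_map_injOn (padded_map_injOn hf N) L
      ⟨b7, fun l hl ↦ ⟨b8 l hl, fun x hx ↦ w1 x (Or.inr (Or.inr (List.mem_flatten.2 ⟨l, hl, hx⟩)))⟩⟩
      ⟨c7, fun l hl ↦ ⟨c8 l hl, fun x hx ↦ w2 x (Or.inr (Or.inr (List.mem_flatten.2 ⟨l, hl, hx⟩)))⟩⟩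
      h7
    subst e2 e3 e4 e5 e6 e7 h1
    rfl
  · -- three words hold an item, and a fourth one leaves room for its absence
    have hU : Fintype.card (Option U) ≤ (2 ^ b) ^ 4 := by
      have h1 : Fintype.card (Sym2 (Fin n)) ≤ n * n := by
        rw [Sym2.card, Fintype.card_fin, Nat.choose_two_right]
        refine Nat.div_le_of_le_mul ?_
        have := NeZero.pos n
        simp only [Nat.add_sub_cancel]
        nlinarith
      have h2 : Fintype.card U ≤ (2 ^ b) ^ 3 := by
        simp only [U, Fintype.card_prod, Fintype.card_fin]
        calc _ ≤ (2 ^ b * 2 ^ b) * 2 ^ b := by gcongr; exact h1.trans (Nat.mul_le_mul hn hn)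
          _ = _ := by ring
      rw [Fintype.card_option, pow_succ _ 3]
      have : 1 ≤ (2 ^ b) ^ 3 := Nat.one_le_pow _ _ (by omega)
      nlinarith
    have hlist : ∀ N : ℕ, Fintype.card (Fin N → Option U) ≤ (2 ^ b) ^ (4 * N) := by
      intro N
      rw [Fintype.card_fun, Fintype.card_fin, pow_mul]
      exact Nat.pow_le_pow_left hU N
    have hlists : ∀ N T : ℕ, Fintype.card (Fin T → Option (Fin N → Option U)) ≤
        (2 ^ b) ^ ((4 * N + 1) * T) := by
      intro N T
      rw [Fintype.card_fun, Fintype.card_fin, pow_mul]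
      refine Nat.pow_le_pow_left ?_ T
      rw [Fintype.card_option, pow_succ]
      have : 1 ≤ (2 ^ b) ^ (4 * N) := Nat.one_le_pow _ _ (by omega)
      have := hlist N
      nlinarith
    have hp : p + 1 ≤ (2 ^ b) ^ p := calc
      p + 1 ≤ 2 ^ p := Nat.lt_two_pow_self
      _ ≤ (2 ^ b) ^ p := Nat.pow_le_pow_left hB p
    have hsplit : (2 ^ b) ^ wordCount n p a T N L = 2 ^ b * ((2 ^ b) ^ p * ((2 ^ b) ^ (4 * n) *
        ((2 ^ b) ^ (4 * a) * ((2 ^ b) ^ (4 * N) * ((2 ^ b) ^ ((4 * n + 1) * T) *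
        (2 ^ b) ^ ((4 * N + 1) * L)))))) := by
      rw [wordCount]
      ring
    rw [hsplit]
    simp only [Y, Fintype.card_prod (Fin n), Fintype.card_prod (Fin (p + 1)), Fintype.card_prod,
      Fintype.card_fin n, Fintype.card_fin (p + 1)]
    gcongr
    exacts [hlist n, hlist a, hlist N, hlists n T, hlists N L]

end State

/-! ### Graphs stored as lists of items -/

section ItemLists

variable {n : ℕ} {G : SimpleGraph (Fin n)} {w : Sym2 (Fin n) → ℝ≥0}

/-- The graph formed by the edges of a list of items. -/
def graphOf (l : List (Item n)) : SimpleGraph (Fin n) :=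
  SimpleGraph.fromEdgeSet {e | ∃ c, (e, c) ∈ l}

/-- The graph formed by the edges of weight at most `c` of a list of items. -/
def lightGraph (l : List (Item n)) (c : ℝ≥0) : SimpleGraph (Fin n) :=
  SimpleGraph.fromEdgeSet {e | ∃ c' ≤ c, (e, c') ∈ l}

open Classical in
/-- The weight that a list of items gives to an edge; it is `0` if the edge does not occur. -/
noncomputable def weightOf (l : List (Item n)) (e : Sym2 (Fin n)) : ℝ≥0 :=
  if h : ∃ c, (e, c) ∈ l then h.choose else 0

/-- All items of the list are edges of `G` with their weights. -/
def IsDrawnFrom (G : SimpleGraph (Fin n)) (w : Sym2 (Fin n) → ℝ≥0) (l : List (Item n)) : Prop :=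
  ∀ x ∈ l, x.1 ∈ G.edgeSet ∧ x.2 = w x.1

lemma IsDrawnFrom.mono {l l' : List (Item n)} (h : IsDrawnFrom G w l) (hl : l' ⊆ l) :
    IsDrawnFrom G w l' := fun x hx ↦ h x (hl hx)

lemma graphOf_mono {l l' : List (Item n)} (h : l ⊆ l') : graphOf l ≤ graphOf l' :=
  SimpleGraph.fromEdgeSet_mono fun _ ⟨c, hc⟩ ↦ ⟨c, h hc⟩

lemma lightGraph_mono {l : List (Item n)} {c c' : ℝ≥0} (h : c ≤ c') :
    lightGraph l c ≤ lightGraph l c' :=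
  SimpleGraph.fromEdgeSet_mono fun _ ⟨d, hd, hd'⟩ ↦ ⟨d, hd.trans h, hd'⟩

lemma IsDrawnFrom.graphOf_le {l : List (Item n)} (h : IsDrawnFrom G w l) : graphOf l ≤ G := by
  refine (SimpleGraph.fromEdgeSet_le _).2 ?_
  rintro e ⟨⟨c, hc⟩, -⟩
  exact (h _ hc).1

lemma IsDrawnFrom.graphOf_adj {l : List (Item n)} (h : IsDrawnFrom G w l) {u v : Fin n} {c : ℝ≥0}
    (hx : (s(u, v), c) ∈ l) : (graphOf l).Adj u v := by
  rw [graphOf, SimpleGraph.fromEdgeSet_adj]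
  exact ⟨⟨c, hx⟩, SimpleGraph.Adj.ne (G := G) (h _ hx).1⟩

lemma IsDrawnFrom.weightOf_eq {l : List (Item n)} (h : IsDrawnFrom G w l) {e : Sym2 (Fin n)}
    (he : e ∈ (graphOf l).edgeSet) : weightOf l e = w e := by
  have hex : ∃ c, (e, c) ∈ l := by
    rw [graphOf, SimpleGraph.edgeSet_fromEdgeSet] at he
    exact he.1
  rw [weightOf, dif_pos hex]
  exact (h _ hex.choose_spec).2

lemma IsDrawnFrom.wdist_weightOf {l : List (Item n)} (h : IsDrawnFrom G w l) (u v : Fin n) :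
    wdist (graphOf l) (weightOf l) u v = wdist (graphOf l) w u v :=
  wdist_congr (fun _ he ↦ h.weightOf_eq he) u v

lemma IsDrawnFrom.wdist_le_of_lightGraph {l : List (Item n)} (h : IsDrawnFrom G w l)
    {H : SimpleGraph (Fin n)} (hH : graphOf l ≤ H) {c : ℝ≥0} {u v : Fin n}
    (huv : (lightGraph l c).Reachable u v) : wdist H w u v ≤ n * c := by
  classical
  obtain ⟨p, hp⟩ := huv.exists_isPath
  have hlight : lightGraph l c ≤ H := le_trans
    (b := graphOf l) (SimpleGraph.fromEdgeSet_mono fun e ⟨d, hd⟩ ↦ ⟨d, hd.2⟩) hH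
  have hlen : (p.edges.map w).sum ≤ n * c := by
    have h1 : (p.edges.map w).sum ≤ (p.edges.map w).length • c := by
      refine List.sum_le_card_nsmul _ _ fun d hd ↦ ?_
      obtain ⟨e, he, rfl⟩ := List.mem_map.1 hd
      have := p.edges_subset_edgeSet he
      rw [lightGraph, SimpleGraph.edgeSet_fromEdgeSet] at this
      obtain ⟨⟨d, hd, hd'⟩, -⟩ := this
      rw [← (h _ hd').2]
      exact hd
    refine h1.trans ?_
    rw [nsmul_eq_mul]
    have := hp.length_lt
    rw [Fintype.card_fin] at this
    gcongr
    simp [this.le]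
  calc wdist H w u v ≤ wdist (lightGraph l c) w u v := wdist_anti hlight u v
    _ ≤ walkWeight w p := wdist_le p
    _ ≤ _ := by rw [walkWeight]; exact_mod_cast hlen

/-! ### Maintaining a bottleneck forest -/

/-- `F` is a set of at most `n` items of `τ` that joins the ends of every edge of `τ` by edges that
are not heavier. -/
structure IsForestOf (F τ : List (Item n)) : Prop where
  subset : F ⊆ τ
  length_le : F.length ≤ n
  reachable : ∀ u v c, (s(u, v), c) ∈ τ → (lightGraph F c).Reachable u v

open Classical in
/-- A bottleneck forest of a list of items. -/
noncomputable def pruneForest (l : List (Item n)) : List (Item n) :=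
  if h : ∃ F, IsForestOf F l then h.choose else []

lemma IsDrawnFrom.isForestOf_pruneForest {l : List (Item n)} (h : IsDrawnFrom G w l) :
    IsForestOf (pruneForest l) l := by
  classical
  have hex : ∃ F, IsForestOf F l := by
    rcases l with _ | ⟨x, l⟩
    · exact ⟨[], by simp, by simp, by simp⟩
    set l' := x :: l
    have : Nonempty (Fin n) := ⟨x.1.inf⟩
    obtain ⟨F, hF, hcard, hr⟩ := exists_bottleneckForest w (l'.map Prod.fst).toFinset
    refine ⟨F.toList.map fun e ↦ (e, w e), ?_, ?_, fun u v c hc ↦ ?_⟩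
    · intro y hy
      obtain ⟨e, he, rfl⟩ := List.mem_map.1 hy
      have := hF (Finset.mem_toList.1 he)
      obtain ⟨⟨e', c⟩, hz, rfl⟩ := List.mem_map.1 (List.mem_toFinset.1 this)
      have hc := (h _ hz).2
      simp only at hc ⊢
      rwa [← hc]
    · simpa using hcard.le
    · refine (hr u v (List.mem_toFinset.2 (List.mem_map.2 ⟨_, hc, rfl⟩))).mono
        (SimpleGraph.fromEdgeSet_mono ?_)
      rintro e ⟨he, hle⟩
      have := (h _ hc).2
      simp only at this
      exact ⟨w e, this ▸ hle, List.mem_map.2 ⟨e, Finset.mem_toList.2 he, rfl⟩⟩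
  rw [pruneForest, dif_pos hex]
  exact hex.choose_spec

lemma reachable_of_forall_adj {V : Type*} {H H' : SimpleGraph V}
    (h : ∀ u v, H.Adj u v → H'.Reachable u v) {u v : V} (huv : H.Reachable u v) :
    H'.Reachable u v := by
  obtain ⟨p⟩ := huv
  induction p with
  | nil => exact SimpleGraph.Reachable.refl _
  | cons hadj _ ih => exact (h _ _ hadj).trans ih

lemma IsForestOf.insert {F τ : List (Item n)} {x : Item n} (hF : IsForestOf F τ)
    (hτ : IsDrawnFrom G w (τ ++ [x])) : IsForestOf (pruneForest (x :: F)) (τ ++ [x]) := by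
  have hsub : x :: F ⊆ τ ++ [x] := by
    intro y hy
    rcases List.mem_cons.1 hy with rfl | hy
    · simp
    · exact List.mem_append_left _ (hF.subset hy)
  have hF' := (hτ.mono hsub).isForestOf_pruneForest
  refine ⟨fun y hy ↦ hsub (hF'.subset hy), hF'.length_le, fun u v c hc ↦ ?_⟩
  rcases List.mem_append.1 hc with hc | hc
  · refine reachable_of_forall_adj (fun a b hab ↦ ?_) (hF.reachable u v c hc)
    rw [lightGraph, SimpleGraph.fromEdgeSet_adj] at hab
    obtain ⟨⟨c', hc', hmem⟩, -⟩ := hab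
    exact (hF'.reachable a b c' (List.mem_cons_of_mem _ hmem)).mono (lightGraph_mono hc')
  · rw [List.mem_singleton] at hc
    exact hF'.reachable u v c (hc ▸ List.mem_cons_self)

lemma isForestOf_foldl {τ : List (Item n)} (hτ : IsDrawnFrom G w τ) :
    IsForestOf (τ.foldl (fun F x ↦ pruneForest (x :: F)) []) τ := by
  induction τ using List.reverseRecOn with
  | nil => exact ⟨by simp, by simp, by simp⟩
  | append_singleton τ x ih =>
    rw [List.foldl_append]
    exact (ih (hτ.mono (by simp))).insert hτ

end ItemLists

/-! ### Greedy spanners of contracted graphs -/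

section Spanner

/-- An edge between far vertices closes no short cycle: the rest of the cycle would be a short walk
between its ends. -/
lemma girth_sup_edge {V : Type*} {Q : SimpleGraph V} {a b : V} {m : ℕ}
    (hg : ∀ v (c : Q.Walk v v), c.IsCycle → m < c.length)
    (hab : ∀ p : Q.Walk a b, m ≤ p.length) (v : V) (c : (Q ⊔ SimpleGraph.edge a b).Walk v v)
    (hc : c.IsCycle) : m < c.length := by
  classical
  have hmem : ∀ e ∈ (Q ⊔ SimpleGraph.edge a b).edgeSet, e ≠ s(a, b) → e ∈ Q.edgeSet := by
    intro e he hne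
    rw [SimpleGraph.edgeSet_sup] at he
    rcases he with he | he
    · exact he
    · rw [SimpleGraph.edge, SimpleGraph.edgeSet_fromEdgeSet] at he
      exact absurd he.1 hne
  by_cases he : s(a, b) ∈ c.edges
  · have ha : a ∈ c.support := c.fst_mem_support_of_mem_edges he
    set c' := c.rotate a ha with hc'
    have hcyc : c'.IsCycle := hc.rotate ha
    have hlen : c'.length = c.length := by simp [hc']
    have he' : s(a, b) ∈ c'.edges := (c.rotate_edges a ha).mem_iff.2 he
    have hb : b ∈ c'.support := c'.snd_mem_support_of_mem_edges he'
    have hspec := c'.take_spec hb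
    have hedges : c'.edges = (c'.takeUntil b hb).edges ++ (c'.dropUntil b hb).edges := by
      rw [← SimpleGraph.Walk.edges_append, hspec]
    have hlen' : c'.length = (c'.takeUntil b hb).length + (c'.dropUntil b hb).length := by
      rw [← SimpleGraph.Walk.length_append, hspec]
    have hnd := hcyc.isTrail.edges_nodup
    rw [hedges] at hnd he'
    have hdisj := List.disjoint_of_nodup_append hnd
    have hpos : ∀ {x y : V} (p : (Q ⊔ SimpleGraph.edge a b).Walk x y), s(a, b) ∈ p.edges →
        0 < p.length := by
      intro x y p hp
      rw [← SimpleGraph.Walk.length_edges]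
      exact List.length_pos_of_mem hp
    rcases List.mem_append.1 he' with h1 | h1
    · have h2 := hab ((c'.dropUntil b hb).transfer Q fun e he ↦ hmem e
        (SimpleGraph.Walk.edges_subset_edgeSet _ he) fun h ↦ hdisj h1 (h ▸ he)).reverse
      rw [SimpleGraph.Walk.length_reverse, SimpleGraph.Walk.length_transfer] at h2
      have := hpos _ h1
      omega
    · have h2 := hab ((c'.takeUntil b hb).transfer Q fun e he ↦ hmem e
        (SimpleGraph.Walk.edges_subset_edgeSet _ he) fun h ↦ hdisj (h ▸ he) h1)
      rw [SimpleGraph.Walk.length_transfer] at h2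
      have := hpos _ h1
      omega
  · have := hg v (c.transfer Q fun e h ↦ hmem e (c.edges_subset_edgeSet h) fun h' ↦ he (h' ▸ h))
      (hc.transfer _)
    rwa [SimpleGraph.Walk.length_transfer] at this

variable {n : ℕ} {G : SimpleGraph (Fin n)} {w : Sym2 (Fin n) → ℝ≥0}

/-- The scale of an item: the integer part of the binary logarithm of its weight. -/
noncomputable def scale (x : Item n) : ℤ := Int.log 2 x.2

/-- A representative of the component of `v` in the part of the forest that is contracted at
scale `i`: its edges of weight at most `2 ^ i / n`. -/
noncomputable def contract (F : List (Item n)) (i : ℤ) (v : Fin n) : Fin n :=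
  ((lightGraph F (2 ^ i / n)).connectedComponentMk v).out

lemma contract_eq_iff {F : List (Item n)} {i : ℤ} {u v : Fin n} :
    contract F i u = contract F i v ↔ (lightGraph F (2 ^ i / n)).Reachable u v := by
  rw [← SimpleGraph.ConnectedComponent.eq]
  refine ⟨fun h ↦ ?_, fun h ↦ congrArg Quot.out h⟩
  have := congrArg (lightGraph F (2 ^ i / n)).connectedComponentMk h
  simpa [contract, SimpleGraph.connectedComponentMk, Quot.out_eq] using this

/-- The image of the items of `K` of scale `i` under the contraction for scale `i`. -/
noncomputable def contractedGraph (F K : List (Item n)) (i : ℤ) : SimpleGraph (Fin n) :=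
  SimpleGraph.fromEdgeSet {e | ∃ x ∈ K, scale x = i ∧ x.1.map (contract F i) = e}

/-- The ends of the item are joined by fewer than `2 * k` edges in the contracted graph of its
scale, or its weight is `0`. -/
def IsSpanned (k : ℕ) (F K : List (Item n)) (x : Item n) : Prop :=
  x.2 = 0 ∨ ∃ u v, x.1 = s(u, v) ∧ ∃ p : (contractedGraph F K (scale x)).Walk
    (contract F (scale x) u) (contract F (scale x) v), p.length < 2 * k

open Classical in
/-- Adds an item to the spanner unless it is spanned already. -/
noncomputable def extendSpanner (k : ℕ) (F K : List (Item n)) (x : Item n) : List (Item n) :=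
  if IsSpanned k F K x then K else x :: K

open Classical in
/-- `K` is a list of items of `τ` that span all other items of `τ`, and its contracted graphs have
no short cycles and no multiple edges. -/
structure IsSpannerOf (k : ℕ) (F K τ : List (Item n)) : Prop where
  subset : K ⊆ τ
  count_le : ∀ i, K.countP (fun x ↦ scale x = i) ≤
    (contractedGraph F K i).edgeSet.ncard
  girth : ∀ i v (c : (contractedGraph F K i).Walk v v), c.IsCycle → 2 * k < c.length
  spanned : ∀ x ∈ τ, x ∈ K ∨ IsSpanned k F K x

lemma contractedGraph_mono {F K K' : List (Item n)} (h : K ⊆ K') (i : ℤ) :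
    contractedGraph F K i ≤ contractedGraph F K' i :=
  SimpleGraph.fromEdgeSet_mono fun _ ⟨x, hx, hx'⟩ ↦ ⟨x, h hx, hx'⟩

lemma IsSpanned.mono {k : ℕ} {F K K' : List (Item n)} {x : Item n} (h : IsSpanned k F K x)
    (hK : K ⊆ K') : IsSpanned k F K' x := by
  rcases h with h | ⟨u, v, huv, p, hp⟩
  · exact Or.inl h
  · exact Or.inr ⟨u, v, huv, p.mapLe (contractedGraph_mono hK _), by simpa using hp⟩

lemma IsSpannerOf.insert {k : ℕ} (hk : 1 ≤ k) {F K τ : List (Item n)} {x : Item n}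
    (h : IsSpannerOf k F K τ) : IsSpannerOf k F (extendSpanner k F K x) (τ ++ [x]) := by
  classical
  unfold extendSpanner
  split_ifs with hx
  · refine ⟨fun y hy ↦ List.mem_append_left _ (h.subset hy), h.count_le, h.girth, fun y hy ↦ ?_⟩
    rcases List.mem_append.1 hy with hy | hy
    · exact h.spanned y hy
    · rw [List.mem_singleton.1 hy]
      exact Or.inr hx
  · have hfar : ∀ u v, x.1 = s(u, v) → ∀ p : (contractedGraph F K (scale x)).Walk
        (contract F (scale x) u) (contract F (scale x) v), 2 * k ≤ p.length := by
      intro u v huv p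
      by_contra! hlt
      exact hx (Or.inr ⟨u, v, huv, p, hlt⟩)
    obtain ⟨u, v, huv⟩ : ∃ u v, x.1 = s(u, v) := by
      induction hx' : x.1 with | _ u v => exact ⟨u, v, rfl⟩
    have hfar := hfar u v huv
    set a := contract F (scale x) u with ha
    set b := contract F (scale x) v with hb
    have hab : a ≠ b := by
      intro hab
      have := hfar (SimpleGraph.Walk.nil.copy rfl hab)
      simp at this
      omega
    have hnadj : ¬ (contractedGraph F K (scale x)).Adj a b := by
      intro hadj
      have := hfar (SimpleGraph.Walk.cons hadj .nil)
      simp at this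
      omega
    have hsame : contractedGraph F (x :: K) (scale x) =
        contractedGraph F K (scale x) ⊔ SimpleGraph.edge a b := by
      rw [contractedGraph, contractedGraph, SimpleGraph.edge, ← SimpleGraph.fromEdgeSet_union]
      congr 1
      ext e
      simp only [List.mem_cons, exists_eq_or_imp, true_and, huv, Sym2.map_mk, Set.mem_ofPred_eq,
        Set.mem_union, Set.mem_singleton_iff]
      rw [or_comm, eq_comm (a := e)]
    have hother : ∀ i, i ≠ scale x → contractedGraph F (x :: K) i = contractedGraph F K i := by
      intro i hi
      rw [contractedGraph, contractedGraph]
      congr 1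
      ext e
      simp [hi.symm]
    refine ⟨?_, fun i ↦ ?_, fun i ↦ ?_, fun y hy ↦ ?_⟩
    · intro y hy
      rcases List.mem_cons.1 hy with rfl | hy
      · simp
      · exact List.mem_append_left _ (h.subset hy)
    · by_cases hi : i = scale x
      · subst hi
        rw [hsame, List.countP_cons_of_pos (by simp)]
        have hedge : (SimpleGraph.edge a b).edgeSet = {s(a, b)} := by
          simp [SimpleGraph.edge, hab]
        rw [SimpleGraph.edgeSet_sup, hedge, Set.union_singleton,
          Set.ncard_insert_of_notMem (by simpa using hnadj) (Set.toFinite _)]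
        exact Nat.succ_le_succ (h.count_le (scale x))
      · rw [hother i hi, List.countP_cons_of_neg (by simpa using fun h ↦ hi h.symm)]
        exact h.count_le i
    · by_cases hi : i = scale x
      · subst hi
        rw [hsame]
        exact girth_sup_edge (h.girth _) hfar
      · rw [hother i hi]
        exact h.girth i
    · rcases List.mem_append.1 hy with hy | hy
      · rcases h.spanned y hy with hy | hy
        · exact Or.inl (List.mem_cons_of_mem _ hy)
        · exact Or.inr (hy.mono (List.subset_cons_self _ _))
      · rw [List.mem_singleton.1 hy]
        exact Or.inl List.mem_cons_self

lemma isSpannerOf_foldl {k : ℕ} (hk : 1 ≤ k) (F τ : List (Item n)) :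
    IsSpannerOf k F (τ.foldl (extendSpanner k F) []) τ := by
  induction τ using List.reverseRecOn with
  | nil =>
    have hbot : ∀ i, contractedGraph F ([] : List (Item n)) i = ⊥ := by
      intro i
      ext a b
      simp [contractedGraph]
    refine ⟨by simp, fun i ↦ by simp, fun i v c hc ↦ ?_, by simp⟩
    exact absurd (hc.mapLe (hbot i).le) (SimpleGraph.isAcyclic_bot _)
  | append_singleton τ x ih =>
    rw [List.foldl_append]
    exact ih.insert hk

/-- An item that is spanned at its scale has stretch `O(k)`: each of the fewer than `2 * k` edges
of the contracted graph costs at most twice the weight of the item, and each of the components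
passed, whose forest paths have fewer than `n` edges, at most the weight of the item. -/
lemma IsSpannerOf.wdist_le {k : ℕ} (hk : 1 ≤ k) {F K τ : List (Item n)} (hτ : IsDrawnFrom G w τ)
    (hF : IsForestOf F τ) (hK : IsSpannerOf k F K τ) {H : SimpleGraph (Fin n)}
    (hFH : graphOf F ≤ H) (hKH : graphOf K ≤ H) {u v : Fin n} {c : ℝ≥0} (hx : (s(u, v), c) ∈ τ) :
    wdist H w u v ≤ 6 * k * c := by
  have hFd := hτ.mono hF.subset
  have hKd := hτ.mono hK.subset
  have hn0 : (n : ℝ≥0) ≠ 0 := by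
    have := u.pos
    exact_mod_cast this.ne'
  have hcontract : ∀ i u v, contract F i u = contract F i v →
      wdist H w u v ≤ ((2 ^ i : ℝ≥0) : ℝ≥0∞) := by
    intro i u v h
    refine (hFd.wdist_le_of_lightGraph hFH (contract_eq_iff.1 h)).trans (le_of_eq ?_)
    rw [← ENNReal.coe_natCast, ← ENNReal.coe_mul, mul_div_cancel₀ _ hn0]
  have hwalk : ∀ i a b (p : (contractedGraph F K i).Walk a b) u v, contract F i u = a →
      contract F i v = b →
        wdist H w u v ≤ ((p.length * 2 ^ (i + 1) + (p.length + 1) * 2 ^ i : ℝ≥0) : ℝ≥0∞) := by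
    intro i a b p
    induction p with
    | nil =>
      intro u v hu hv
      simpa using hcontract i u v (hu.trans hv.symm)
    | @cons a a' b hadj p ih =>
      intro u v hu hv
      rw [contractedGraph, SimpleGraph.fromEdgeSet_adj] at hadj
      obtain ⟨⟨⟨e, d⟩, hmem, hscale, hmap⟩, -⟩ := hadj
      obtain ⟨y, z, rfl, hy, hz⟩ : ∃ y z, e = s(y, z) ∧ contract F i y = a ∧
          contract F i z = a' := by
        induction e with | _ y z =>
        rw [Sym2.map_mk, Sym2.eq_iff] at hmap
        rcases hmap with ⟨h1, h2⟩ | ⟨h1, h2⟩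
        exacts [⟨y, z, rfl, h1, h2⟩, ⟨z, y, Sym2.eq_swap, h2, h1⟩]
      have e1 := hcontract i u y (hu.trans hy.symm)
      have e2 : wdist H w y z ≤ ((2 ^ (i + 1) : ℝ≥0) : ℝ≥0∞) := by
        refine (wdist_adj (hKH (hKd.graphOf_adj hmem))).trans ?_
        rw [← (hKd _ hmem).2, ENNReal.coe_le_coe, ← hscale]
        have := Int.lt_zpow_succ_log_self (b := 2) one_lt_two d
        exact_mod_cast this.le
      have e3 := ih z v hz hv
      calc wdist H w u v ≤ wdist H w u y + (wdist H w y z + wdist H w z v) :=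
            (wdist_triangle u y v).trans (by gcongr; exact wdist_triangle ..)
        _ ≤ _ := add_le_add e1 (add_le_add e2 e3)
        _ = _ := by
            rw [← ENNReal.coe_add, ← ENNReal.coe_add, SimpleGraph.Walk.length_cons]
            congr 1
            push_cast
            ring
  have hc1 : (c : ℝ≥0∞) ≤ 6 * k * c := by
    have : (1 : ℝ≥0∞) ≤ 6 * k := by
      have : (1 : ℝ≥0∞) ≤ k := by exact_mod_cast hk
      calc (1 : ℝ≥0∞) ≤ k := this
        _ = 1 * k := (one_mul _).symm
        _ ≤ 6 * k := by gcongr; norm_num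
    calc (c : ℝ≥0∞) = 1 * c := (one_mul _).symm
      _ ≤ _ := by gcongr
  rcases hK.spanned _ hx with hxK | h0 | ⟨u', v', huv, p, hp⟩
  · refine (wdist_adj (hKH (hKd.graphOf_adj hxK))).trans ?_
    rw [← (hKd _ hxK).2]
    exact hc1
  · have := hFd.wdist_le_of_lightGraph hFH (hF.reachable u v c hx)
    simp only at h0
    subst h0
    simpa using this
  · have hc0 : c ≠ 0 ∨ c = 0 := ne_or_eq c 0
    rcases hc0 with hc0 | rfl
    · have hle : (2 : ℝ≥0) ^ (Int.log 2 c) ≤ c := by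
        have := Int.zpow_log_le_self (b := 2) one_lt_two (pos_iff_ne_zero.2 hc0)
        simpa using this
      have h1 := hwalk _ _ _ p u' v' rfl rfl
      have h2 : wdist H w u v = wdist H w u' v' := by
        rcases Sym2.eq_iff.1 huv with ⟨rfl, rfl⟩ | ⟨rfl, rfl⟩
        exacts [rfl, wdist_comm _ _]
      rw [h2]
      refine h1.trans ?_
      have h3 : (p.length * 2 ^ (Int.log 2 c + 1) + (p.length + 1) * 2 ^ (Int.log 2 c) : ℝ≥0) ≤
          6 * k * c := by
        have hp' : (p.length : ℝ≥0) + 1 ≤ 2 * k := by exact_mod_cast hp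
        rw [zpow_add₀ two_ne_zero, zpow_one]
        calc _ ≤ (2 * k : ℝ≥0) * (2 ^ (Int.log 2 c) * 2) + (2 * k) * 2 ^ (Int.log 2 c) := by
              gcongr
              exact le_self_add.trans hp'
          _ = 6 * k * 2 ^ (Int.log 2 c) := by ring
          _ ≤ _ := by gcongr
      calc _ ≤ ((6 * k * c : ℝ≥0) : ℝ≥0∞) := ENNReal.coe_le_coe.2 h3
        _ = _ := by push_cast; rfl
    · have := hFd.wdist_le_of_lightGraph hFH (hF.reachable u v 0 hx)
      simpa using this

end Spanner

section SpannerSize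

variable {n : ℕ} {G : SimpleGraph (Fin n)} {w : Sym2 (Fin n) → ℝ≥0}

/-- The scales at which a forest edge may join contracted components that are not isolated. -/
def InWindow (i : ℤ) (f : Item n) : Prop := (2 : ℝ≥0) ^ i < n * f.2 ∧ f.2 < (2 : ℝ≥0) ^ (i + 1)

open Classical in
lemma card_inWindow_le (I : Finset ℤ) (f : Item n) :
    Finset.card {i ∈ I | InWindow i f} ≤ Nat.clog 2 n + 1 := by
  by_cases h0 : f.2 = 0
  · have : ({i ∈ I | InWindow i f} : Finset ℤ) = ∅ := by
      ext i
      simp [InWindow, h0]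
    simp [this]
  have hpos : 0 < f.2 := pos_iff_ne_zero.2 h0
  have hsub : ({i ∈ I | InWindow i f} : Finset ℤ) ⊆
      Finset.Icc (Int.log 2 f.2) (Int.log 2 f.2 + Nat.clog 2 n) := by
    intro i hi
    obtain ⟨-, h1, h2⟩ := Finset.mem_filter.1 hi
    rw [Finset.mem_Icc]
    constructor
    · have := (Int.lt_zpow_iff_log_lt (b := 2) one_lt_two hpos).1 (by exact_mod_cast h2)
      omega
    · have h3 : (n : ℝ≥0) ≤ 2 ^ (Nat.clog 2 n : ℤ) := by
        rw [zpow_natCast]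
        exact_mod_cast Nat.le_pow_clog one_lt_two n
      have h4 : f.2 < (2 : ℝ≥0) ^ (Int.log 2 f.2 + 1) := by
        exact_mod_cast Int.lt_zpow_succ_log_self (b := 2) one_lt_two f.2
      have h5 : (2 : ℝ≥0) ^ i < 2 ^ ((Nat.clog 2 n : ℤ) + (Int.log 2 f.2 + 1)) := by
        rw [zpow_add₀ two_ne_zero]
        calc _ < n * f.2 := h1
          _ ≤ 2 ^ (Nat.clog 2 n : ℤ) * f.2 := by gcongr
          _ < _ := by gcongr
      have := (zpow_lt_zpow_iff_right₀ (one_lt_two : (1 : ℝ≥0) < 2)).1 h5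
      omega
  refine (Finset.card_le_card hsub).trans ?_
  rw [Int.card_Icc]
  omega

open Classical in
/-- The contracted components that are not isolated at scale `i` are ends of forest edges whose
weight lies in the window of that scale. -/
lemma IsSpannerOf.countP_scale_le {k : ℕ} (hk : 1 ≤ k) {D : ℝ} (hD : 0 ≤ D) (hDk : n ≤ D ^ k)
    {F K τ : List (Item n)} (hF : IsForestOf F τ) (hK : IsSpannerOf k F K τ) (i : ℤ) :
    (K.countP (fun x ↦ scale x = i) : ℝ) ≤ D * (2 * F.countP (fun f ↦ InWindow i f)) := by
  set A : Finset (Fin n) := ((F.filter fun f ↦ InWindow i f).flatMap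
    fun f ↦ [contract F i f.1.inf, contract F i f.1.sup]).toFinset with hA
  have hAcard : A.card ≤ 2 * F.countP (fun f ↦ InWindow i f) := by
    refine (List.toFinset_card_le _).trans ?_
    rw [List.length_flatMap, List.countP_eq_length_filter]
    simp [mul_comm]
  have hmem : ∀ a b, (contractedGraph F K i).Adj a b → a ∈ A := by
    intro a b hab
    rw [contractedGraph, SimpleGraph.fromEdgeSet_adj] at hab
    obtain ⟨⟨⟨e, c⟩, hmem, hscale, hmap⟩, hne⟩ := hab
    obtain ⟨u, v, rfl, hu, hv⟩ : ∃ u v, e = s(u, v) ∧ contract F i u = a ∧ contract F i v = b := by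
      induction e with | _ y z =>
      rw [Sym2.map_mk, Sym2.eq_iff] at hmap
      rcases hmap with ⟨h1, h2⟩ | ⟨h1, h2⟩
      exacts [⟨y, z, rfl, h1, h2⟩, ⟨z, y, Sym2.eq_swap, h2, h1⟩]
    obtain ⟨p⟩ := hF.reachable u v c (hK.subset hmem)
    obtain ⟨d, -, hx, hy⟩ := p.exists_boundary_dart {t | contract F i t = a} hu
      (fun h ↦ hne (h.symm.trans hv))
    have hadj := d.adj
    set x := d.fst
    set y := d.snd
    change contract F i x = a at hx
    change ¬ contract F i y = a at hy
    rw [lightGraph, SimpleGraph.fromEdgeSet_adj] at hadj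
    obtain ⟨⟨c', hc', hf⟩, hxy⟩ := hadj
    have hwin : InWindow i ((s(x, y), c') : Item n) := by
      constructor
      · by_contra! hle
        refine hy ?_
        rw [← hx, eq_comm, contract_eq_iff]
        refine SimpleGraph.Adj.reachable ?_
        rw [lightGraph, SimpleGraph.fromEdgeSet_adj]
        refine ⟨⟨c', ?_, hf⟩, hxy⟩
        have hn : (0 : ℝ≥0) < n := by exact_mod_cast x.pos
        rw [le_div_iff₀ hn, mul_comm]
        exact hle
      · refine lt_of_le_of_lt hc' ?_
        rw [← hscale]
        exact_mod_cast Int.lt_zpow_succ_log_self (b := 2) one_lt_two c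
    rw [hA, List.mem_toFinset, List.mem_flatMap]
    refine ⟨_, List.mem_filter.2 ⟨hf, by simpa using hwin⟩, ?_⟩
    rcases le_total x y with h | h
    · simp [h, hx]
    · simp [h, hx]
  have h1 : (K.countP (fun x ↦ scale x = i) : ℝ) ≤ (contractedGraph F K i).edgeSet.ncard := by
    exact_mod_cast hK.count_le i
  refine h1.trans ((ncard_edgeSet_le_of_girth hk hD (hK.girth i) A hmem ?_).trans ?_)
  · refine le_trans ?_ hDk
    exact_mod_cast (Finset.card_le_univ A).trans (by simp)
  · gcongr
    exact_mod_cast hAcard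

lemma IsSpannerOf.length_le {k : ℕ} (hk : 1 ≤ k) {D : ℝ} (hD : 0 ≤ D) (hDk : n ≤ D ^ k)
    {F K τ : List (Item n)} (hF : IsForestOf F τ) (hK : IsSpannerOf k F K τ) :
    (K.length : ℝ) ≤ D * (2 * (n * (Nat.clog 2 n + 1))) := by
  classical
  set I := (K.map scale).toFinset
  have hlen : K.length = ∑ i ∈ I, K.countP (fun x ↦ scale x = i) := by
    rw [← List.length_map (f := scale), ← List.sum_toFinset_count_eq_length]
    refine Finset.sum_congr rfl fun i _ ↦ ?_
    rw [List.count, List.countP_map]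
    refine List.countP_congr fun x _ ↦ ?_
    simp
  have hwin : ∀ F : List (Item n), ∑ i ∈ I, F.countP (fun f ↦ InWindow i f) ≤
      F.length * (Nat.clog 2 n + 1) := by
    intro F
    induction F with
    | nil => simp
    | cons f F ih =>
      simp only [List.countP_cons, Finset.sum_add_distrib, List.length_cons, add_mul, one_mul]
      refine add_le_add ih ?_
      have := card_inWindow_le I f
      rw [Finset.card_filter] at this
      simpa using this
  have hFn : ∑ i ∈ I, F.countP (fun f ↦ InWindow i f) ≤ n * (Nat.clog 2 n + 1) :=
    (hwin F).trans (Nat.mul_le_mul_right _ hF.length_le)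
  calc (K.length : ℝ) = ∑ i ∈ I, (K.countP (fun x ↦ scale x = i) : ℝ) := by
        rw [hlen]; push_cast; rfl
    _ ≤ ∑ i ∈ I, D * (2 * F.countP (fun f ↦ InWindow i f)) :=
        Finset.sum_le_sum fun i _ ↦ hK.countP_scale_le hk hD hDk hF i
    _ = D * (2 * ((∑ i ∈ I, F.countP (fun f ↦ InWindow i f) : ℕ) : ℝ)) := by
        rw [← Finset.mul_sum, ← Finset.mul_sum]; push_cast; rfl
    _ ≤ _ := by gcongr; exact_mod_cast hFn

end SpannerSize

/-! ### Shortest path trees as lists of items, and their potentials -/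

section Potentials

variable {n : ℕ} {G : SimpleGraph (Fin n)} {w : Sym2 (Fin n) → ℝ≥0}

/-- `l` consists of at most `n` items of `S` and has the same distances from `s` as `S`. -/
def IsTreeOf (s : Fin n) (S l : List (Item n)) : Prop :=
  l ⊆ S ∧ l.length ≤ n ∧
    ∀ v, wdist (graphOf l) (weightOf S) s v = wdist (graphOf S) (weightOf S) s v

open Classical in
/-- A shortest path tree from `s` in the graph of the items of `S`. -/
noncomputable def treeOf (s : Fin n) (S : List (Item n)) : List (Item n) :=
  if h : ∃ l, IsTreeOf s S l then h.choose else []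

lemma IsDrawnFrom.isTreeOf_treeOf {S : List (Item n)} (h : IsDrawnFrom G w S) (s : Fin n) :
    IsTreeOf s S (treeOf s S) := by
  classical
  have hex : ∃ l, IsTreeOf s S l := by
    obtain ⟨T, hT, hac, -, hdist⟩ := exists_shortestPathTree (graphOf S) (weightOf S) s
    have hedge : ∀ e ∈ T.edgeSet, (e, w e) ∈ S := by
      intro e he
      have he' := SimpleGraph.edgeSet_mono hT he
      rw [graphOf, SimpleGraph.edgeSet_fromEdgeSet] at he'
      obtain ⟨⟨c, hc⟩, -⟩ := he'
      have := (h _ hc).2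
      simp only at this
      exact this ▸ hc
    have hgraph : graphOf (T.edgeFinset.toList.map fun e ↦ (e, w e)) = T := by
      rw [graphOf]
      conv_rhs => rw [← T.fromEdgeSet_edgeSet]
      congr 1
      ext e
      simp
    have : Nonempty (Fin n) := ⟨s⟩
    refine ⟨T.edgeFinset.toList.map fun e ↦ (e, w e), ?_, ?_, fun v ↦ ?_⟩
    · intro x hx
      obtain ⟨e, he, rfl⟩ := List.mem_map.1 hx
      exact hedge e (by simpa using he)
    · have := card_lt_of_isAcyclic (F := T.edgeFinset)
        (fun e he ↦ T.not_isDiag_of_mem_edgeSet (by simpa using he)) (by simpa using hac)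
      simpa using this.le
    · rw [hgraph, hdist v]
  rw [treeOf, dif_pos hex]
  exact hex.choose_spec

lemma IsTreeOf.wdist_eq {s : Fin n} {S l : List (Item n)} (h : IsTreeOf s S l)
    (hS : IsDrawnFrom G w S) (v : Fin n) : wdist (graphOf l) w s v = wdist (graphOf S) w s v := by
  rw [← hS.wdist_weightOf, ← h.2.2 v]
  exact (wdist_congr (fun e he ↦ hS.weightOf_eq
    (SimpleGraph.edgeSet_mono (graphOf_mono h.1) he)) s v).symm

/-- The distances from `s` in the graph of a list of items, as real numbers; vertices that cannot be
reached have the value `0`. -/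
noncomputable def potential (s : Fin n) (l : List (Item n)) (v : Fin n) : ℝ :=
  (wdist (graphOf l) (weightOf l) s v).toReal

lemma abs_toReal_wdist_sub_le {H : SimpleGraph (Fin n)} (s : Fin n) {u v : Fin n} {r : ℝ≥0}
    (h : wdist H w u v ≤ r) : |(wdist H w s u).toReal - (wdist H w s v).toReal| ≤ r := by
  have key : ∀ {u v}, wdist H w u v ≤ r →
      (wdist H w s u).toReal ≤ (wdist H w s v).toReal + r := by
    intro u v h
    by_cases hv : wdist H w s v = ∞
    · have hu : wdist H w s u = ∞ := by
        by_contra hu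
        refine absurd hv (ne_top_of_le_ne_top ?_ (wdist_triangle s u v))
        exact ENNReal.add_ne_top.2 ⟨hu, ne_top_of_le_ne_top ENNReal.coe_ne_top h⟩
      rw [hu, hv]
      simp
    · have h1 : wdist H w s u ≤ wdist H w s v + r := by
        refine (wdist_triangle s v u).trans ?_
        rw [wdist_comm v u]
        gcongr
      have h2 := ENNReal.toReal_mono (ENNReal.add_ne_top.2 ⟨hv, ENNReal.coe_ne_top⟩) h1
      rwa [ENNReal.toReal_add hv ENNReal.coe_ne_top, ENNReal.coe_toReal] at h2
  rw [abs_sub_le_iff]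
  exact ⟨by linarith [key h], by linarith [key (u := v) (v := u) (by rwa [wdist_comm])]⟩

/-- The potential differs by more than its weight between the ends of the item. -/
def IsViolated (φ : Fin n → ℝ) (x : Item n) : Prop := Violates φ x ∨ Violates (-φ) x

lemma isViolated_iff {φ : Fin n → ℝ} {u v : Fin n} {c : ℝ≥0} :
    IsViolated φ (s(u, v), c) ↔ (c : ℝ) < |φ u - φ v| := by
  rw [lt_abs]
  rcases le_total u v with h | h
  · simp [IsViolated, Violates, h, neg_add_eq_sub]
  · simp [IsViolated, Violates, h, neg_add_eq_sub, or_comm]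

open Classical in
/-- The number of stored trees whose potential violates the item. -/
noncomputable def violationCount (s : Fin n) (trees : List (List (Item n))) (x : Item n) : ℕ :=
  trees.countP fun l ↦ IsViolated (potential s l) x

/-- The total importance of the items of `τ`, where an item that is violated by `j` of the trees
has importance `g ^ j`. -/
noncomputable def importance (g : ℕ) (s : Fin n) (trees : List (List (Item n)))
    (τ : List (Item n)) : ℕ :=
  (τ.map fun x ↦ g ^ violationCount s trees x).sum

end Potentials

/-! ### The algorithm -/

section Algorithm

variable {n : ℕ} {G : SimpleGraph (Fin n)} {w : Sym2 (Fin n) → ℝ≥0}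

/-- The parameters of the algorithm. -/
structure Parameters where
  /-- the quality of the spanner -/
  k : ℕ
  /-- the factor by which the importance of an edge grows when a tree violates it -/
  g : ℕ
  /-- the number of trees -/
  T : ℕ
  /-- the size of a block of the summary -/
  N : ℕ
  /-- a bound on the number of digits of the binary counter of the summary -/
  L : ℕ
  /-- the relative error of a halving -/
  η : ℝ
  /-- the additive error of a halving -/
  c : ℝ

/-- The summary of the stream `τ`, every item of which is repeated as often as its importance
says. -/
noncomputable def summarize (P : Parameters) (s : Fin n) (trees : List (List (Item n)))
    (τ : List (Item n)) : List (Item n) × List (List (Item n)) :=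
  τ.foldl (fun S x ↦ (List.replicate (P.g ^ violationCount s trees x) x).foldl
    (feed P.η P.c P.N) S) ([], [])

/-- The algorithm's operation on the arrival of an item. -/
noncomputable def State.step (P : Parameters) (S : State n) (x : Item n) : State n :=
  if S.phase = 0 then { S with forest := pruneForest (x :: S.forest) }
  else if S.phase = 1 then { S with spanner := extendSpanner P.k S.forest S.spanner x }
  else
    { S with
      summary := (List.replicate (P.g ^ violationCount S.src S.trees x) x).foldl
        (feed P.η P.c P.N) S.summary }

/-- The algorithm's operation at the end of a pass. -/
noncomputable def State.endPass (S : State n) : State n :=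
  if S.phase < 2 then { S with phase := S.phase + 1 }
  else { S with
    phase := S.phase + 1
    trees := S.trees ++ [treeOf S.src (S.forest ++ S.spanner ++
      (S.summary.1 ++ S.summary.2.flatten))]
    summary := ([], []) }

/-- The state at the beginning. -/
def State.start (s : Fin n) : State n := ⟨s, 0, [], [], [], ([], [])⟩

/-- The output: a shortest path tree of the union of all stored trees. -/
noncomputable def State.output (S : State n) : SimpleGraph (Fin n) :=
  (exists_shortestPathTree (graphOf S.trees.flatten) (weightOf S.trees.flatten) S.src).choose

/-- The forest computed in the first pass. -/
noncomputable def forestOf (σ : List (Item n)) : List (Item n) :=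
  σ.foldl (fun F x ↦ pruneForest (x :: F)) []

/-- The spanner computed in the second pass. -/
noncomputable def spannerOf (k : ℕ) (σ : List (Item n)) : List (Item n) :=
  σ.foldl (extendSpanner k (forestOf σ)) []

/-- The items that are stored at the end of a round. -/
noncomputable def stored (P : Parameters) (s : Fin n) (σ : List (Item n))
    (trees : List (List (Item n))) : List (Item n) :=
  forestOf σ ++ spannerOf P.k σ ++
    ((summarize P s trees σ).1 ++ (summarize P s trees σ).2.flatten)

/-- The trees stored after `i` rounds. -/
noncomputable def treesAfter (P : Parameters) (s : Fin n) (σ : List (Item n)) :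
    ℕ → List (List (Item n))
  | 0 => []
  | i + 1 => treesAfter P s σ i ++ [treeOf s (stored P s σ (treesAfter P s σ i))]

lemma foldl_step_zero (P : Parameters) (s : Fin n) (τ : List (Item n)) (F : List (Item n)) :
    τ.foldl (State.step P) ⟨s, 0, F, [], [], ([], [])⟩ =
      ⟨s, 0, τ.foldl (fun F x ↦ pruneForest (x :: F)) F, [], [], ([], [])⟩ := by
  induction τ generalizing F with
  | nil => rfl
  | cons x τ ih => simp only [List.foldl_cons]; rw [← ih]; rfl

lemma foldl_step_one (P : Parameters) (s : Fin n) (τ F K : List (Item n)) :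
    τ.foldl (State.step P) ⟨s, 1, F, K, [], ([], [])⟩ =
      ⟨s, 1, F, τ.foldl (extendSpanner P.k F) K, [], ([], [])⟩ := by
  induction τ generalizing K with
  | nil => rfl
  | cons x τ ih => simp only [List.foldl_cons]; rw [← ih]; rfl

lemma foldl_step_two (P : Parameters) (s : Fin n) (i : ℕ) (τ F K : List (Item n))
    (trees : List (List (Item n))) :
    τ.foldl (State.step P) ⟨s, i + 2, F, K, trees, ([], [])⟩ =
      ⟨s, i + 2, F, K, trees, summarize P s trees τ⟩ := by
  unfold summarize
  generalize (([], []) : List (Item n) × List (List (Item n))) = S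
  induction τ generalizing S with
  | nil => rfl
  | cons x τ ih => simp only [List.foldl_cons]; rw [← ih]; rfl

lemma passOn_iterate_one (P : Parameters) (s : Fin n) (σ : List (Item n)) :
    (passOn (State.step P) State.endPass σ)^[1] (State.start s) =
      ⟨s, 1, forestOf σ, [], [], ([], [])⟩ := by
  rw [Function.iterate_one, passOn, State.start, foldl_step_zero]
  rfl

lemma passOn_iterate (P : Parameters) (s : Fin n) (σ : List (Item n)) (i : ℕ) :
    (passOn (State.step P) State.endPass σ)^[i + 2] (State.start s) =
      ⟨s, i + 2, forestOf σ, spannerOf P.k σ, treesAfter P s σ i, ([], [])⟩ := by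
  induction i with
  | zero =>
    rw [Function.iterate_succ_apply', passOn_iterate_one, passOn, foldl_step_one]
    rfl
  | succ i ih =>
    rw [show i + 1 + 2 = (i + 2) + 1 by ring, Function.iterate_succ_apply', ih, passOn,
      foldl_step_two]
    rfl

end Algorithm

/-! ### The multiplicative weights argument -/

section Analysis

variable {n : ℕ} {G : SimpleGraph (Fin n)} {w : Sym2 (Fin n) → ℝ≥0}

/-- The relations between the parameters on which the correctness of the algorithm rests. -/
structure Parameters.Valid (P : Parameters) (n : ℕ) : Prop where
  k_pos : 1 ≤ P.k
  three_le : 3 ≤ n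
  two_le_g : 2 ≤ P.g
  le_g_pow : n ≤ P.g ^ P.k
  T_pos : 1 ≤ P.T
  N_pos : 1 ≤ P.N
  η_pos : 0 < P.η
  η_le : P.η ≤ 1 / 2
  c_eq : P.c = 2 * n * Real.log ((n ^ 2 : ℕ) : ℝ) / P.η
  lt_L : n ^ 3 < 2 ^ P.L
  error_le : ∀ i < P.L, errorRate P.η P.c P.N i ≤ 1 / (2 * P.g * P.T)

variable {P : Parameters} {σ : List (Item n)}

lemma Parameters.Valid.c_nonneg (hP : P.Valid n) : 0 ≤ P.c := by
  rw [hP.c_eq]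
  have := hP.η_pos
  have : 0 ≤ Real.log ((n ^ 2 : ℕ) : ℝ) := Real.log_natCast_nonneg _
  positivity

lemma Parameters.Valid.exists_isHalf (hP : P.Valid n) (hlen : σ.length + 1 ≤ n ^ 2)
    (l : List (Item n)) (hl : l.length = 2 * P.N) (hlσ : ∀ x ∈ l, x ∈ {x | x ∈ σ}) :
    ∃ l', IsHalf P.η P.c l l' := by
  classical
  rw [hP.c_eq]
  exact StreamSSSP.exists_isHalf hP.η_pos hP.η_le σ.toFinset
    ((Nat.add_le_add_right (List.toFinset_card_le σ) 1).trans hlen) hl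
    fun x hx ↦ List.mem_toFinset.2 (hlσ x hx)

open Classical in
lemma violCount_replicate (φ : Fin n → ℝ) (m : ℕ) (x : Item n) :
    violCount φ (List.replicate m x) = if Violates φ x then m else 0 := by
  simp [violCount, List.countP_replicate]

open Classical in
/-- The summary of a pass stands for the list in which every item is repeated as often as its
importance says. -/
lemma exists_summaryRepresents (hP : P.Valid n) (hlen : σ.length + 1 ≤ n ^ 2) (s : Fin n)
    (trees : List (List (Item n))) {τ : List (Item n)} (hτ : τ ⊆ σ) :
    ∃ τ', SummaryRepresents P.η P.c P.N (summarize P s trees τ) τ' ∧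
      τ'.length = importance P.g s trees τ ∧ τ' ⊆ τ ∧
      ∀ φ, violCount φ τ' =
        (τ.map fun x ↦ if Violates φ x then P.g ^ violationCount s trees x else 0).sum := by
  induction τ using List.reverseRecOn with
  | nil => exact ⟨[], SummaryRepresents.nil hP.N_pos, rfl, by simp, fun φ ↦ rfl⟩
  | append_singleton τ x ih =>
    obtain ⟨τ', h1, h2, h3, h4⟩ := ih fun y hy ↦ hτ (by simp [hy])
    set m := P.g ^ violationCount s trees x with hm
    refine ⟨List.replicate m x ++ τ', ?_, ?_, ?_, fun φ ↦ ?_⟩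
    · rw [summarize, List.foldl_append]
      exact h1.feed_replicate hP.η_pos.le hP.c_nonneg (hP.exists_isHalf hlen) (hτ (by simp))
        (fun y hy ↦ hτ (by simp [h3 hy])) m
    · rw [List.length_append, List.length_replicate, h2, importance, importance, List.map_append,
        List.sum_append, add_comm]
      simp [hm]
    · intro y hy
      rcases List.mem_append.1 hy with hy | hy
      · simp [List.eq_of_mem_replicate hy]
      · simp [h3 hy]
    · rw [violCount_append, h4, violCount_replicate, List.map_append, List.sum_append, add_comm]
      simp [hm]

lemma forestOf_isForestOf (hσ : IsDrawnFrom G w σ) : IsForestOf (forestOf σ) σ :=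
  isForestOf_foldl hσ

lemma stored_subset (hP : P.Valid n) (hσ : IsDrawnFrom G w σ) (hlen : σ.length + 1 ≤ n ^ 2)
    (s : Fin n) (trees : List (List (Item n))) : stored P s σ trees ⊆ σ := by
  obtain ⟨τ', h1, -, h3, -⟩ :=
    exists_summaryRepresents hP hlen s trees (List.Subset.refl σ)
  refine List.append_subset.2 ⟨List.append_subset.2 ⟨(forestOf_isForestOf hσ).subset,
    (isSpannerOf_foldl hP.k_pos _ σ).subset⟩, fun x hx ↦ h3 (h1.subset hx)⟩

/-- The graph stored at the end of a round contains a forest and a spanner, so that it stretches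
no edge of the stream too much. -/
lemma wdist_stored_le (hP : P.Valid n) (hσ : IsDrawnFrom G w σ) (s : Fin n)
    (trees : List (List (Item n))) {u v : Fin n} {c : ℝ≥0} (hx : (s(u, v), c) ∈ σ) :
    wdist (graphOf (stored P s σ trees)) w u v ≤ ((6 * P.k * c : ℝ≥0) : ℝ≥0∞) := by
  have := (isSpannerOf_foldl hP.k_pos (forestOf σ) σ).wdist_le hP.k_pos hσ
    (forestOf_isForestOf hσ) (H := graphOf (stored P s σ trees))
    (graphOf_mono fun x hx ↦ by simp [stored, hx])
    (graphOf_mono fun x hx ↦ by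
      change x ∈ spannerOf P.k σ at hx
      simp [stored, hx]) hx
  exact_mod_cast this

/-- The tree found at the end of a round. -/
noncomputable def newTree (P : Parameters) (s : Fin n) (σ : List (Item n))
    (trees : List (List (Item n))) : List (Item n) := treeOf s (stored P s σ trees)

lemma newTree_isTreeOf (hP : P.Valid n) (hσ : IsDrawnFrom G w σ) (hlen : σ.length + 1 ≤ n ^ 2)
    (s : Fin n) (trees : List (List (Item n))) :
    IsTreeOf s (stored P s σ trees) (newTree P s σ trees) :=
  (hσ.mono (stored_subset hP hσ hlen s trees)).isTreeOf_treeOf s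

lemma potential_newTree (hP : P.Valid n) (hσ : IsDrawnFrom G w σ) (hlen : σ.length + 1 ≤ n ^ 2)
    (s : Fin n) (trees : List (List (Item n))) (v : Fin n) :
    potential s (newTree P s σ trees) v =
      (wdist (graphOf (stored P s σ trees)) w s v).toReal := by
  have hd := hσ.mono (stored_subset hP hσ hlen s trees)
  have ht := newTree_isTreeOf hP hσ hlen s trees
  rw [potential, (hd.mono ht.1).wdist_weightOf, ht.wdist_eq hd]

lemma abs_potential_newTree_sub_le (hP : P.Valid n) (hσ : IsDrawnFrom G w σ)
    (hlen : σ.length + 1 ≤ n ^ 2) (s : Fin n) (trees : List (List (Item n))) {u v : Fin n}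
    {c : ℝ≥0} (hx : (s(u, v), c) ∈ σ) :
    |potential s (newTree P s σ trees) u - potential s (newTree P s σ trees) v| ≤
      6 * P.k * c := by
  rw [potential_newTree hP hσ hlen, potential_newTree hP hσ hlen]
  exact_mod_cast abs_toReal_wdist_sub_le s (wdist_stored_le hP hσ s trees hx)

lemma not_isViolated_of_mem_stored (hP : P.Valid n) (hσ : IsDrawnFrom G w σ)
    (hlen : σ.length + 1 ≤ n ^ 2) (s : Fin n) (trees : List (List (Item n))) {x : Item n}
    (hx : x ∈ stored P s σ trees) : ¬ IsViolated (potential s (newTree P s σ trees)) x := by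
  obtain ⟨e, c⟩ := x
  induction e with | _ u v =>
  have hd := hσ.mono (stored_subset hP hσ hlen s trees)
  rw [isViolated_iff, not_lt, potential_newTree hP hσ hlen, potential_newTree hP hσ hlen]
  refine abs_toReal_wdist_sub_le s ((wdist_adj (hd.graphOf_adj hx)).trans ?_)
  rw [← (hd _ hx).2]

open Classical in
lemma importance_append (g : ℕ) (s : Fin n) (trees : List (List (Item n))) (l τ : List (Item n)) :
    importance g s (trees ++ [l]) τ = (τ.map fun x ↦ g ^ violationCount s trees x *
      if IsViolated (potential s l) x then g else 1).sum := by
  rw [importance]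
  congr 1
  refine List.map_congr_left fun x _ ↦ ?_
  rw [violationCount, violationCount, List.countP_append, pow_add]
  by_cases h : IsViolated (potential s l) x <;> simp [h]

open Classical in
/-- One step of the multiplicative weights method: the potential of the new tree violates only
items of small total importance, whence the total importance hardly grows. -/
lemma importance_newTree_le (hP : P.Valid n) (hσ : IsDrawnFrom G w σ)
    (hlen : σ.length + 1 ≤ n ^ 2) (s : Fin n) (trees : List (List (Item n)))
    (himp : importance P.g s trees σ ≤ n ^ 3) :
    (importance P.g s (trees ++ [newTree P s σ trees]) σ : ℝ) ≤
      (1 + 1 / P.T) * importance P.g s trees σ := by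
  obtain ⟨τ', h1, h2, -, h4⟩ :=
    exists_summaryRepresents hP hlen s trees (List.Subset.refl σ)
  have hg : (0 : ℝ) < P.g := by have := hP.two_le_g; positivity
  have hT : (0 : ℝ) < P.T := by have := hP.T_pos; positivity
  set δ : ℝ := 1 / (2 * P.g * P.T) with hδ
  have hδ0 : 0 ≤ δ := by positivity
  have hL := h1.length_slots_le (by rw [h2]; exact himp.trans_lt hP.lt_L)
  set φ := potential s (newTree P s σ trees)
  have hviol : ∀ x ∈ (summarize P s trees σ).1 ++ (summarize P s trees σ).2.flatten,
      ¬ IsViolated φ x := fun x hx ↦ not_isViolated_of_mem_stored hP hσ hlen s trees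
        (List.mem_append_right _ hx)
  have e1 := h1.violCount_le (fun i hi ↦ hP.error_le i (by omega)) hδ0
    fun x hx h ↦ hviol x hx (Or.inl h)
  have e2 := h1.violCount_le (fun i hi ↦ hP.error_le i (by omega)) hδ0
    fun x hx h ↦ hviol x hx (Or.inr h)
  rw [h4, h2] at e1 e2
  have hsum : importance P.g s (trees ++ [newTree P s σ trees]) σ ≤
      importance P.g s trees σ + P.g *
        ((σ.map fun x ↦ if Violates φ x then P.g ^ violationCount s trees x else 0).sum +
        (σ.map fun x ↦ if Violates (-φ) x then P.g ^ violationCount s trees x else 0).sum) := by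
    rw [importance_append, importance, ← List.sum_map_add, ← List.sum_map_mul_left,
      ← List.sum_map_add]
    refine List.sum_le_sum fun x _ ↦ ?_
    generalize P.g ^ violationCount s trees x = m
    have hm := Nat.zero_le (m * P.g)
    by_cases hx : Violates φ x <;> by_cases hx' : Violates (-φ) x <;>
      simp only [IsViolated, φ] at hx hx' ⊢ <;> simp [hx, hx'] <;> nlinarith
  have hsumR : (importance P.g s (trees ++ [newTree P s σ trees]) σ : ℝ) ≤
      importance P.g s trees σ + P.g * (δ * importance P.g s trees σ +
        δ * importance P.g s trees σ) := by
    refine le_trans (Nat.cast_le.2 hsum) ?_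
    rw [Nat.cast_add, Nat.cast_mul, Nat.cast_add]
    gcongr
  refine hsumR.trans (le_of_eq ?_)
  rw [hδ]
  field_simp
  ring

/-- The total importance starts below `n ^ 2` and grows by a factor of at most `1 + 1 / T` in each
of the `T` rounds, hence by a factor of at most `e` altogether. -/
lemma importance_treesAfter_le (hP : P.Valid n) (hσ : IsDrawnFrom G w σ)
    (hlen : σ.length + 1 ≤ n ^ 2) (s : Fin n) {i : ℕ} (hi : i ≤ P.T) :
    importance P.g s (treesAfter P s σ i) σ ≤ n ^ 3 := by
  have hT : (0 : ℝ) < P.T := by have := hP.T_pos; positivity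
  have hn : (3 : ℝ) ≤ n := by exact_mod_cast hP.three_le
  have hgrow : ∀ i ≤ P.T, importance P.g s (treesAfter P s σ i) σ ≤ n ^ 3 ∧
      (importance P.g s (treesAfter P s σ i) σ : ℝ) ≤ n ^ 2 * (1 + 1 / P.T) ^ i := by
    intro i
    induction i with
    | zero =>
      intro _
      have h0 : importance P.g s (treesAfter P s σ 0) σ = σ.length := by
        simp [importance, treesAfter, violationCount]
      rw [h0]
      have h1 : σ.length ≤ n ^ 2 := by omega
      refine ⟨h1.trans (Nat.pow_le_pow_right (by have := hP.three_le; omega) (by norm_num)), ?_⟩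
      rw [pow_zero, mul_one]
      exact_mod_cast h1
    | succ i ih =>
      intro hi
      obtain ⟨ih1, ih2⟩ := ih (by omega)
      have hstep := importance_newTree_le hP hσ hlen s _ ih1
      have hR : (importance P.g s (treesAfter P s σ (i + 1)) σ : ℝ) ≤
          n ^ 2 * (1 + 1 / P.T) ^ (i + 1) := by
        refine hstep.trans ?_
        rw [pow_succ, mul_comm]
        calc _ ≤ (n ^ 2 * (1 + 1 / P.T) ^ i : ℝ) * (1 + 1 / P.T) := by gcongr
          _ = _ := by ring
      refine ⟨?_, hR⟩
      -- `(1 + 1 / T) ^ (i + 1) ≤ e < 3 ≤ n`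
      have hexp : (1 + 1 / (P.T : ℝ)) ^ (i + 1) ≤ n := calc
        (1 + 1 / (P.T : ℝ)) ^ (i + 1) ≤ Real.exp (1 / P.T) ^ (i + 1) := by
            gcongr
            rw [add_comm]
            exact Real.add_one_le_exp _
        _ = Real.exp ((i + 1 : ℕ) * (1 / P.T)) := (Real.exp_nat_mul _ _).symm
        _ ≤ Real.exp 1 := by
            rw [Real.exp_le_exp, mul_one_div, div_le_one hT]
            exact_mod_cast hi
        _ ≤ n := by linarith [Real.exp_one_lt_d9]
      have : (importance P.g s (treesAfter P s σ (i + 1)) σ : ℝ) ≤ n ^ 3 := by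
        refine hR.trans ?_
        rw [pow_succ (n : ℝ) 2]
        gcongr
      exact_mod_cast this
  exact (hgrow i hi).1

lemma length_treesAfter (s : Fin n) (i : ℕ) : (treesAfter P s σ i).length = i := by
  induction i with
  | zero => rfl
  | succ i ih => simp [treesAfter, ih]

lemma exists_of_mem_treesAfter {s : Fin n} {i : ℕ} {l : List (Item n)}
    (hl : l ∈ treesAfter P s σ i) : ∃ trees, l = newTree P s σ trees := by
  induction i with
  | zero => simp [treesAfter] at hl
  | succ i ih =>
    rw [treesAfter, List.mem_append, List.mem_singleton] at hl
    rcases hl with hl | hl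
    exacts [ih hl, ⟨_, hl⟩]

/-- No item is violated by more than `3 * k` of the trees, since its importance would exceed the
total importance. -/
lemma violationCount_treesAfter_le (hP : P.Valid n) (hσ : IsDrawnFrom G w σ)
    (hlen : σ.length + 1 ≤ n ^ 2) (s : Fin n) {x : Item n} (hx : x ∈ σ) :
    violationCount s (treesAfter P s σ P.T) x ≤ 3 * P.k := by
  have h1 : P.g ^ violationCount s (treesAfter P s σ P.T) x ≤
      importance P.g s (treesAfter P s σ P.T) σ :=
    List.single_le_sum (fun _ _ ↦ Nat.zero_le _) _ (List.mem_map.2 ⟨x, hx, rfl⟩)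
  have h2 : P.g ^ violationCount s (treesAfter P s σ P.T) x ≤ P.g ^ (3 * P.k) := calc
    _ ≤ _ := h1
    _ ≤ n ^ 3 := importance_treesAfter_le hP hσ hlen s le_rfl
    _ ≤ (P.g ^ P.k) ^ 3 := Nat.pow_le_pow_left hP.le_g_pow 3
    _ = P.g ^ (3 * P.k) := by rw [← pow_mul, mul_comm]
  exact (Nat.pow_le_pow_iff_right (by have := hP.two_le_g; omega)).1 h2

open Classical in
lemma sum_map_le_of_countP {α : Type*} (l : List α) (f f' : α → ℝ) (p : α → Prop) {a b : ℝ}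
    (hf : ∀ x ∈ l, f x ≤ f' x + (a + if p x then b else 0)) :
    (l.map f).sum ≤ (l.map f').sum + (l.length * a + l.countP p * b) := by
  induction l with
  | nil => simp
  | cons x l ih =>
    have h1 := hf x (by simp)
    have h2 := ih fun y hy ↦ hf y (by simp [hy])
    rw [List.map_cons, List.sum_cons, List.map_cons, List.sum_cons, List.length_cons,
      List.countP_cons]
    by_cases hx : p x <;> simp only [hx, if_true, if_false, decide_true, decide_false,
      Bool.false_eq_true] at h1 ⊢ <;> push_cast <;> linarith

/-- On average over all trees, the potential grows along an edge by at most `1 + ε` times the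
weight. -/
lemma sum_potential_le (hP : P.Valid n) (hσ : IsDrawnFrom G w σ)
    (hlen : σ.length + 1 ≤ n ^ 2) {ε : ℝ} (hε : 18 * (P.k : ℝ) ^ 2 ≤ ε * P.T) (s : Fin n)
    {u v : Fin n} {c : ℝ≥0} (hx : (s(u, v), c) ∈ σ) :
    ((treesAfter P s σ P.T).map fun l ↦ potential s l v).sum ≤
      ((treesAfter P s σ P.T).map fun l ↦ potential s l u).sum + P.T * (1 + ε) * c := by
  classical
  have hc : (0 : ℝ) ≤ c := c.2
  have h1 := sum_map_le_of_countP (treesAfter P s σ P.T)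
    (fun l ↦ potential s l v) (fun l ↦ potential s l u)
    (fun l ↦ IsViolated (potential s l) (s(u, v), c)) (a := c) (b := 6 * P.k * c) (by
      intro l hl
      obtain ⟨trees, rfl⟩ := exists_of_mem_treesAfter hl
      have h := le_abs_self (potential s (newTree P s σ trees) v -
        potential s (newTree P s σ trees) u)
      rw [abs_sub_comm] at h
      split_ifs with hviol
      · have := abs_potential_newTree_sub_le hP hσ hlen s trees hx
        linarith
      · rw [isViolated_iff, not_lt] at hviol
        linarith)
  rw [length_treesAfter] at h1
  have h2 : ((violationCount s (treesAfter P s σ P.T) (s(u, v), c) : ℕ) : ℝ) ≤ 3 * P.k := by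
    exact_mod_cast violationCount_treesAfter_le hP hσ hlen s hx
  -- the at most `3 * k` violations cost `6 * k * c` each, and `18 * k ^ 2 * c ≤ ε * T * c`
  have h3 := mul_le_mul_of_nonneg_right h2 (by positivity : (0 : ℝ) ≤ 6 * P.k * c)
  have h4 := mul_le_mul_of_nonneg_right hε hc
  refine h1.trans ?_
  rw [violationCount] at h3
  have h5 : (P.T : ℝ) * c + 3 * P.k * (6 * P.k * c) ≤ P.T * (1 + ε) * c := by linarith
  linarith

lemma sum_potential_le_walkWeight (hP : P.Valid n) (hσ : IsDrawnFrom G w σ)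
    (hG : ∀ e ∈ G.edgeSet, (e, w e) ∈ σ) (hlen : σ.length + 1 ≤ n ^ 2) {ε : ℝ}
    (hε : 18 * (P.k : ℝ) ^ 2 ≤ ε * P.T) (s : Fin n) {u v : Fin n} (p : G.Walk u v) :
    ((treesAfter P s σ P.T).map fun l ↦ potential s l v).sum ≤
      ((treesAfter P s σ P.T).map fun l ↦ potential s l u).sum +
        P.T * (1 + ε) * walkWeight w p := by
  induction p with
  | nil => simp
  | @cons u x v h p ih =>
    have := sum_potential_le hP hσ hlen hε s (hG s(u, x) h)
    rw [walkWeight_cons]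
    push_cast
    linarith

lemma wdist_stored_ne_top (hP : P.Valid n) (hσ : IsDrawnFrom G w σ)
    (hG : ∀ e ∈ G.edgeSet, (e, w e) ∈ σ) (s : Fin n) (trees : List (List (Item n))) {u v : Fin n}
    (huv : G.Reachable u v) : wdist (graphOf (stored P s σ trees)) w u v ≠ ∞ := by
  rw [wdist_ne_top_iff]
  refine reachable_of_forall_adj (fun a b hab ↦ (wdist_ne_top_iff (w := w)).1 ?_) huv
  exact ne_top_of_le_ne_top ENNReal.coe_ne_top (wdist_stored_le hP hσ s trees (hG s(a, b) hab))

lemma treesAfter_flatten_subset (hP : P.Valid n) (hσ : IsDrawnFrom G w σ)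
    (hlen : σ.length + 1 ≤ n ^ 2) (s : Fin n) (i : ℕ) : (treesAfter P s σ i).flatten ⊆ σ := by
  intro x hx
  obtain ⟨l, hl, hx⟩ := List.mem_flatten.1 hx
  obtain ⟨trees, rfl⟩ := exists_of_mem_treesAfter hl
  exact stored_subset hP hσ hlen s trees ((newTree_isTreeOf hP hσ hlen s trees).1 hx)

/-- The union of the trees contains a `1 + ε`-approximate shortest path tree: the distance in it is
at most the average potential. -/
lemma wdist_treesAfter_le (hP : P.Valid n) (hσ : IsDrawnFrom G w σ)
    (hG : ∀ e ∈ G.edgeSet, (e, w e) ∈ σ) (hlen : σ.length + 1 ≤ n ^ 2) {ε : ℝ} (hε0 : 0 < ε)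
    (hε : 18 * (P.k : ℝ) ^ 2 ≤ ε * P.T) (s t : Fin n) :
    wdist (graphOf (treesAfter P s σ P.T).flatten) w s t ≤
      ENNReal.ofReal (1 + ε) * wdist G w s t := by
  rw [wdist.eq_def G, ENNReal.mul_iInf_of_ne (by simp; linarith) ENNReal.ofReal_ne_top]
  refine le_iInf fun p ↦ ?_
  set U := (treesAfter P s σ P.T).flatten with hU
  have hle : ∀ l ∈ treesAfter P s σ P.T, wdist (graphOf U) w s t ≤
      ENNReal.ofReal (potential s l t) := by
    intro l hl
    obtain ⟨trees, rfl⟩ := exists_of_mem_treesAfter hl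
    have hd := hσ.mono (stored_subset hP hσ hlen s trees)
    rw [potential_newTree hP hσ hlen, ENNReal.ofReal_toReal
      (wdist_stored_ne_top hP hσ hG s trees ⟨p⟩),
      ← (newTree_isTreeOf hP hσ hlen s trees).wdist_eq hd]
    exact wdist_anti (graphOf_mono fun x hx ↦ List.mem_flatten.2 ⟨_, hl, hx⟩) s t
  have hT : (0 : ℝ) < P.T := by have := hP.T_pos; positivity
  obtain ⟨l₀, hl₀⟩ : ∃ l, l ∈ treesAfter P s σ P.T := List.exists_mem_of_length_pos (by
    rw [length_treesAfter]; exact hP.T_pos)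
  have hfin : wdist (graphOf U) w s t ≠ ∞ :=
    ne_top_of_le_ne_top ENNReal.ofReal_ne_top (hle l₀ hl₀)
  have hpot : ∀ l ∈ treesAfter P s σ P.T, (wdist (graphOf U) w s t).toReal ≤ potential s l t :=
    fun l hl ↦ ENNReal.toReal_le_of_le_ofReal ENNReal.toReal_nonneg (hle l hl)
  have hsum : P.T * (wdist (graphOf U) w s t).toReal ≤
      ((treesAfter P s σ P.T).map fun l ↦ potential s l t).sum := by
    have := List.card_nsmul_le_sum ((treesAfter P s σ P.T).map fun l ↦ potential s l t)
      (wdist (graphOf U) w s t).toReal (by simpa using hpot)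
    simpa [length_treesAfter] using this
  have hwalk := sum_potential_le_walkWeight hP hσ hG hlen hε s p
  have hzero : ((treesAfter P s σ P.T).map fun l ↦ potential s l s).sum = 0 := by
    refine List.sum_eq_zero fun x hx ↦ ?_
    obtain ⟨l, -, rfl⟩ := List.mem_map.1 hx
    simp [potential]
  rw [hzero, zero_add] at hwalk
  have hfinal : (wdist (graphOf U) w s t).toReal ≤ (1 + ε) * walkWeight w p := by
    refine le_of_mul_le_mul_left ?_ hT
    linarith
  rw [← ENNReal.ofReal_toReal hfin]
  refine (ENNReal.ofReal_le_ofReal hfinal).trans (le_of_eq ?_)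
  rw [ENNReal.ofReal_mul (by linarith), ENNReal.ofReal_coe_nnreal]

lemma isApproxShortestPathTree_output (hP : P.Valid n) (hσ : IsDrawnFrom G w σ)
    (hG : ∀ e ∈ G.edgeSet, (e, w e) ∈ σ) (hlen : σ.length + 1 ≤ n ^ 2) {ε : ℝ} (hε0 : 0 < ε)
    (hε : 18 * (P.k : ℝ) ^ 2 ≤ ε * P.T) (s : Fin n) {S : State n} (hsrc : S.src = s)
    (hS : S.trees = treesAfter P s σ P.T) :
    IsApproxShortestPathTree G w s (1 + ε) S.output := by
  have hd : IsDrawnFrom G w S.trees.flatten :=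
    hσ.mono (hS ▸ treesAfter_flatten_subset hP hσ hlen s P.T)
  obtain ⟨hle, hac, hroot, hdist⟩ := (exists_shortestPathTree (graphOf S.trees.flatten)
    (weightOf S.trees.flatten) S.src).choose_spec
  change S.output ≤ _ at hle
  change S.output.IsAcyclic at hac
  refine ⟨hle.trans hd.graphOf_le, hac, hsrc ▸ hroot, fun t ↦ ?_⟩
  have h1 : wdist S.output w s t = wdist (graphOf S.trees.flatten) w s t := by
    rw [← hd.wdist_weightOf, ← hsrc, ← hdist t]
    exact (wdist_congr (fun e he ↦ hd.weightOf_eq (SimpleGraph.edgeSet_mono hle he)) _ t).symm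
  rw [h1, hS]
  exact wdist_treesAfter_le hP hσ hG hlen hε0 hε s t

end Analysis

/-! ### Space -/

section Space

variable {n : ℕ} {G : SimpleGraph (Fin n)} {w : Sym2 (Fin n) → ℝ≥0}
variable {P : Parameters} {σ : List (Item n)}

lemma length_foldl_extendSpanner_le (k : ℕ) (F K τ : List (Item n)) :
    K.length ≤ (τ.foldl (extendSpanner k F) K).length := by
  induction τ generalizing K with
  | nil => simp
  | cons x τ ih =>
    refine le_trans ?_ (ih (extendSpanner k F K x))
    unfold extendSpanner
    split_ifs <;> simp

/-- Every state met by the algorithm is small. -/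
lemma fits (hP : P.Valid n) (hσ : IsDrawnFrom G w σ) (hlen : σ.length + 1 ≤ n ^ 2)
    {W : Finset ℝ≥0} (hW : ∀ x ∈ σ, x.2 ∈ W) {a : ℕ} (ha : (spannerOf P.k σ).length ≤ a)
    (s : Fin n) {i : ℕ} (hi : i ≤ P.T + 2) {τ : List (Item n)} (hτ : τ <+: σ) :
    (τ.foldl (State.step P) ((passOn (State.step P) State.endPass σ)^[i] (State.start s))).Fits
      W (P.T + 2) a P.T P.N P.L := by
  have hτσ : τ ⊆ σ := hτ.subset
  match i, hi with
  | 0, hi =>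
    rw [Function.iterate_zero, id, State.start, foldl_step_zero]
    have hF := isForestOf_foldl (hσ.mono hτσ)
    exact ⟨by simp, hF.length_le, by simp, by simp, by simp, by simp, by simp, by simp,
      fun x hx ↦ hW x (hτσ (hF.subset (by simpa [State.items] using hx)))⟩
  | 1, hi =>
    rw [passOn_iterate_one, foldl_step_one]
    have hF := forestOf_isForestOf hσ
    have hK := isSpannerOf_foldl hP.k_pos (forestOf σ) τ
    obtain ⟨τ', rfl⟩ := hτ
    refine ⟨by simp, hF.length_le, le_trans ?_ ha, by simp, by simp, by simp, by simp, by simp,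
      fun x hx ↦ hW x ?_⟩
    · simp only [spannerOf, List.foldl_append]
      exact length_foldl_extendSpanner_le _ _ _ _
    · simp only [State.items, List.flatten_nil, List.append_nil, List.mem_append] at hx
      rcases hx with hx | hx
      exacts [hF.subset hx, hτσ (hK.subset hx)]
  | i + 2, hi =>
    rw [passOn_iterate, foldl_step_two]
    have hF := forestOf_isForestOf hσ
    have hK := isSpannerOf_foldl hP.k_pos (forestOf σ) σ
    obtain ⟨τ', h1, h2, h3, -⟩ :=
      exists_summaryRepresents hP hlen s (treesAfter P s σ i) hτσ
    have hlt : τ'.length < 2 ^ P.L := by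
      refine lt_of_le_of_lt ?_ hP.lt_L
      rw [h2]
      refine le_trans ?_ (importance_treesAfter_le hP hσ hlen s (i := i) (by omega))
      exact (hτ.sublist.map _).sum_le_sum fun _ _ ↦ Nat.zero_le _
    refine ⟨hi, hF.length_le, ha, (length_treesAfter s i).le.trans (by omega), fun l hl ↦ ?_,
      h1.1.le, h1.length_slots_le hlt, ?_, fun x hx ↦ hW x ?_⟩
    · obtain ⟨trees, rfl⟩ := exists_of_mem_treesAfter hl
      exact (newTree_isTreeOf hP hσ hlen s trees).2.1
    · obtain ⟨-, τ'', -, hcount⟩ := h1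
      exact hcount.length_of_mem
    · rw [State.items, List.mem_append, List.mem_append, List.mem_append] at hx
      rcases hx with ((hx | hx) | hx) | hx
      exacts [hF.subset hx, hK.subset hx, treesAfter_flatten_subset hP hσ hlen s i hx,
        hτσ (h3 (h1.subset hx))]

lemma length_add_one_le_of_isInsertionStream (hn : 3 ≤ n) (h : IsInsertionStream G w σ) :
    σ.length + 1 ≤ n ^ 2 := by
  obtain ⟨l, hnd, -, rfl⟩ := h
  rw [List.length_map]
  have h1 := hnd.length_le_card
  rw [Sym2.card, Fintype.card_fin, Nat.choose_two_right, Nat.add_sub_cancel] at h1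
  have h2 : (n + 1) * n / 2 + 1 ≤ n ^ 2 := by
    have : (n + 1) * n / 2 * 2 ≤ (n + 1) * n := Nat.div_mul_le_self _ _
    nlinarith
  omega

/-- An algorithm with valid parameters that stores at most `a` spanner edges. -/
lemma exists_detAlgorithm_of_valid {ε : ℝ} (hP : P.Valid n) (hε0 : 0 < ε)
    (hε : 18 * (P.k : ℝ) ^ 2 ≤ ε * P.T) {b : ℕ} (hn : n ≤ 2 ^ b) {W : Finset ℝ≥0}
    (hW : W.card ≤ 2 ^ b) {D : ℝ} (hD : 0 ≤ D) (hDk : n ≤ D ^ P.k) {a : ℕ}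
    (ha : D * (2 * (n * (Nat.clog 2 n + 1))) < a + 1) :
    ∃ A : DetAlgorithm n (wordCount n (P.T + 2) a P.T P.N P.L) b,
      ∀ (G : SimpleGraph (Fin n)) (w : Sym2 (Fin n) → ℝ≥0) (s : Fin n) (σ : List (Item n)),
        (∀ e ∈ G.edgeSet, w e ∈ W) → IsInsertionStream G w σ →
        IsApproxShortestPathTree G w s (1 + ε) (A.run (P.T + 2) s σ) := by
  have hn3 := hP.three_le
  have : NeZero n := ⟨by omega⟩
  have hb : 1 ≤ b := by
    by_contra! hb
    have : b = 0 := by omega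
    subst this
    omega
  obtain ⟨A, hA⟩ := exists_detAlgorithm_of_state (p := P.T + 2) (a := a) (T := P.T) (N := P.N)
    (L := P.L) hb hn hW State.start (State.step P) State.endPass State.output
  refine ⟨A, fun G w s σ hGW hstream ↦ ?_⟩
  have hlen := length_add_one_le_of_isInsertionStream hn3 hstream
  obtain ⟨l, -, hl, hσl⟩ := hstream
  have hσ : IsDrawnFrom G w σ := by
    intro x hx
    rw [hσl] at hx
    obtain ⟨e, he, rfl⟩ := List.mem_map.1 hx
    exact ⟨(hl e).1 he, rfl⟩
  have hG : ∀ e ∈ G.edgeSet, (e, w e) ∈ σ := by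
    intro e he
    rw [hσl]
    exact List.mem_map.2 ⟨e, (hl e).2 he, rfl⟩
  have hWσ : ∀ x ∈ σ, x.2 ∈ W := fun x hx ↦ (hσ x hx).2 ▸ hGW _ (hσ x hx).1
  have haK : (spannerOf P.k σ).length ≤ a := by
    have := (isSpannerOf_foldl hP.k_pos (forestOf σ) σ).length_le hP.k_pos hD hDk
      (forestOf_isForestOf hσ)
    have h2 := this.trans_lt ha
    exact Nat.lt_succ_iff.1 (by exact_mod_cast h2)
  rw [hA (P.T + 2) s σ
    (fun i hi τ hτ ↦ fits hP hσ hlen hWσ haK s hi.le hτ)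
    (fits hP hσ hlen hWσ haK s le_rfl (List.nil_prefix (l := σ)))]
  rw [passOn_iterate]
  exact isApproxShortestPathTree_output hP hσ hG hlen hε0 hε s rfl rfl

end Space

/-! ### The choice of the parameters -/

section Choice

/-- The parameters for given `n`, `k` and `ε`.  The factor `g` is at least `n ^ (1 / k)`, so that
the importance of an edge cannot be multiplied by it more than `3 * k` times, and
`T ≥ 18 * k ^ 2 / ε` trees make up for a stretch of `6 * k` on these occasions.  With `η = 1 / L` the multiplicative
errors of `L` halvings stay bounded, `c` is then the additive error of a halving, and the block size
`N` makes the sum of the additive errors at most `1 / (2 * g * T)` per item. -/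
noncomputable def chooseParameters (n k : ℕ) (ε : ℝ) : Parameters :=
  let g := ⌈(n : ℝ) ^ (1 / (k : ℝ))⌉₊
  let T := ⌈18 * (k : ℝ) ^ 2 / ε⌉₊
  let L := Nat.log 2 (n ^ 3) + 1
  { k := k
    g := g
    T := T
    N := ⌈64 * n * L ^ 2 * Real.log n * g * T⌉₊
    L := L
    η := 1 / L
    c := 2 * n * Real.log ((n ^ 2 : ℕ) : ℝ) / (1 / L) }

variable {n k : ℕ} {ε : ℝ}

lemma three_le_of_le_log (hk : 1 ≤ k) (hkn : (k : ℝ) ≤ Real.log n) : 3 ≤ n := by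
  by_contra! h
  have h1 : (1 : ℝ) ≤ Real.log n := le_trans (by exact_mod_cast hk) hkn
  have h2 : Real.log n ≤ Real.log 2 := by
    rcases Nat.eq_zero_or_pos n with rfl | hn
    · simp [Real.log_nonneg]
    · exact Real.log_le_log (by exact_mod_cast hn) (by exact_mod_cast (by omega : n ≤ 2))
  linarith [Real.log_two_lt_d9]

lemma exp_one_le_rpow (hk : 1 ≤ k) (hkn : (k : ℝ) ≤ Real.log n) :
    Real.exp 1 ≤ (n : ℝ) ^ (1 / (k : ℝ)) := by
  have hn : (0 : ℝ) < n := by have := three_le_of_le_log hk hkn; positivity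
  have hk0 : (0 : ℝ) < k := by positivity
  rw [Real.rpow_def_of_pos hn, Real.exp_le_exp, mul_one_div, le_div_iff₀ hk0]
  linarith

lemma rpow_pow_eq (hk : 1 ≤ k) : ((n : ℝ) ^ (1 / (k : ℝ))) ^ k = n := by
  rw [one_div]
  exact Real.rpow_inv_natCast_pow (Nat.cast_nonneg n) (by omega)

lemma chooseParameters_valid (hk : 1 ≤ k) (hkn : (k : ℝ) ≤ Real.log n) (hε : 0 < ε) :
    (chooseParameters n k ε).Valid n := by
  have hn := three_le_of_le_log hk hkn
  have hD := exp_one_le_rpow hk hkn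
  have hD2 : 2 < (n : ℝ) ^ (1 / (k : ℝ)) := by linarith [Real.exp_one_gt_d9]
  have hlog : 1 ≤ Real.log n := le_trans (by exact_mod_cast hk) hkn
  have hk0 : (0 : ℝ) < k := by positivity
  have hn0 : (0 : ℝ) < n := by positivity
  have hL2 : 2 ≤ Nat.log 2 (n ^ 3) + 1 := by
    have : 1 ≤ Nat.log 2 (n ^ 3) := Nat.log_pos one_lt_two
      (le_trans (by norm_num : 2 ≤ 3 ^ 3) (Nat.pow_le_pow_left hn 3))
    omega
  have hg : 2 ≤ (chooseParameters n k ε).g := by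
    have : ((2 : ℕ) : ℝ) ≤ ⌈(n : ℝ) ^ (1 / (k : ℝ))⌉₊ :=
      le_trans (by exact_mod_cast hD2.le) (Nat.le_ceil _)
    exact_mod_cast this
  have hT : 1 ≤ (chooseParameters n k ε).T := Nat.ceil_pos.2 (by positivity)
  set P := chooseParameters n k ε with hP
  have hLdef : P.L = Nat.log 2 (n ^ 3) + 1 := rfl
  have hηdef : P.η = 1 / P.L := rfl
  have hcdef : P.c = 2 * n * Real.log ((n ^ 2 : ℕ) : ℝ) / P.η := rfl
  have hL0 : (2 : ℝ) ≤ P.L := by rw [hLdef]; exact_mod_cast hL2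
  have hgR : (0 : ℝ) < P.g := by positivity
  have hTR : (0 : ℝ) < P.T := by positivity
  have hNbound : 64 * n * P.L ^ 2 * Real.log n * P.g * P.T ≤ (P.N : ℝ) := Nat.le_ceil _
  have hNpos : 0 < P.N := Nat.ceil_pos.2 (by
    change (0 : ℝ) < 64 * n * P.L ^ 2 * Real.log n * P.g * P.T
    positivity)
  have hNR : (0 : ℝ) < P.N := by exact_mod_cast hNpos
  refine ⟨hk, hn, hg, ?_, hT, hNpos, ?_, ?_, rfl, Nat.lt_pow_succ_log_self one_lt_two _, ?_⟩
  · have h1 : (n : ℝ) ≤ ((P.g : ℕ) : ℝ) ^ k := by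
      rw [← rpow_pow_eq (n := n) hk]
      gcongr
      exact Nat.le_ceil _
    exact_mod_cast h1
  · rw [hηdef]; positivity
  · rw [hηdef]; gcongr
  · intro i hi
    have hiR : (i : ℝ) ≤ P.L := by exact_mod_cast hi.le
    have hL0' : (0 : ℝ) < P.L := by linarith
    -- `(1 + 2 / L) ^ i ≤ e ^ 2 ≤ 8`
    have hpow : (1 + 2 * P.η) ^ i ≤ 8 := calc
      (1 + 2 * P.η) ^ i ≤ Real.exp (2 * P.η) ^ i := by
          have : 0 ≤ P.η := by rw [hηdef]; positivity
          gcongr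
          rw [add_comm]
          exact Real.add_one_le_exp _
      _ = Real.exp (i * (2 * P.η)) := (Real.exp_nat_mul _ _).symm
      _ ≤ Real.exp 2 := by
          rw [Real.exp_le_exp, hηdef]
          calc (i : ℝ) * (2 * (1 / P.L)) = 2 * (i / P.L) := by ring
            _ ≤ 2 * 1 := by gcongr; exact div_le_one_of_le₀ hiR hL0'.le
            _ = 2 := mul_one _
      _ = Real.exp 1 * Real.exp 1 := by rw [← Real.exp_add]; norm_num
      _ ≤ 8 := by nlinarith [Real.exp_one_lt_d9, Real.exp_pos 1]
    have hc : P.c = 4 * n * P.L * Real.log n := by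
      rw [hcdef, hηdef]
      push_cast
      rw [Real.log_pow]
      field_simp
      norm_num
    have hη0 : 0 ≤ P.η := by rw [hηdef]; positivity
    rw [errorRate, hc, div_le_div_iff₀ hNR (by positivity)]
    calc (i : ℝ) * (1 + 2 * P.η) ^ i * (4 * n * P.L * Real.log n) * (2 * P.g * P.T)
        ≤ P.L * 8 * (4 * n * P.L * Real.log n) * (2 * P.g * P.T) := by gcongr
      _ = 64 * n * P.L ^ 2 * Real.log n * P.g * P.T := by ring
      _ ≤ 1 * P.N := by rw [one_mul]; exact hNbound

lemma wordCount_chooseParameters_le (hk : 1 ≤ k) (hkn : (k : ℝ) ≤ Real.log n) (hε : 0 < ε)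
    (hε1 : ε < 1) {a : ℕ}
    (ha : (a : ℝ) ≤ (n : ℝ) ^ (1 / (k : ℝ)) * (2 * (n * (Nat.clog 2 n + 1)))) :
    let P := chooseParameters n k ε
    (wordCount n (P.T + 2) a P.T P.N P.L : ℝ) ≤ 10 ^ 6 *
      ((k : ℝ) ^ 2 / ε ^ 2 * (n : ℝ) ^ (1 + 1 / (k : ℝ)) * Real.logb 2 n ^ 4) ∧
      ((P.T + 2 : ℕ) : ℝ) ≤ 10 ^ 6 * ((k : ℝ) ^ 2 / ε) := by
  intro P
  have hn := three_le_of_le_log hk hkn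
  have hn3 : (3 : ℝ) ≤ n := by exact_mod_cast hn
  have hn0 : (0 : ℝ) < n := by linarith
  have hk1 : (1 : ℝ) ≤ k := by exact_mod_cast hk
  set D : ℝ := (n : ℝ) ^ (1 / (k : ℝ)) with hDdef
  have hD1 : 1 ≤ D := by
    have := exp_one_le_rpow hk hkn
    linarith [Real.exp_one_gt_d9]
  set lam : ℝ := Real.logb 2 n with hlam
  have hlog : 0 ≤ Real.log n := le_trans (by positivity) hkn
  have hloglam : Real.log n ≤ lam := by
    rw [hlam, Real.logb, le_div_iff₀ (Real.log_pos one_lt_two)]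
    nlinarith [Real.log_two_lt_d9]
  have hlam1 : 1 ≤ lam := by
    rw [hlam, Real.le_logb_iff_rpow_le one_lt_two hn0, Real.rpow_one]
    linarith
  set X : ℝ := (k : ℝ) ^ 2 / ε with hX
  have hX1 : 1 ≤ X := by
    rw [hX, le_div_iff₀ hε]
    nlinarith
  have hg : (P.g : ℝ) ≤ 2 * D := by
    have := (Nat.ceil_lt_add_one (show 0 ≤ D by linarith)).le
    change (P.g : ℝ) ≤ D + 1 at this
    linarith
  have hT : (P.T : ℝ) ≤ 19 * X := by
    have h0 : 0 ≤ 18 * (k : ℝ) ^ 2 / ε := by positivity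
    have := (Nat.ceil_lt_add_one h0).le
    change (P.T : ℝ) ≤ 18 * (k : ℝ) ^ 2 / ε + 1 at this
    have h2 : 18 * (k : ℝ) ^ 2 / ε = 18 * X := by rw [hX]; ring
    linarith
  have hL : (P.L : ℝ) ≤ 4 * lam := by
    have h1 : (Nat.log 2 (n ^ 3) : ℝ) ≤ 3 * lam := by
      have h2 := Real.natLog_le_logb (n ^ 3) 2
      push_cast at h2
      rwa [Real.logb_pow] at h2
    change ((Nat.log 2 (n ^ 3) + 1 : ℕ) : ℝ) ≤ 4 * lam
    push_cast
    linarith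
  have hclog : (Nat.clog 2 n : ℝ) ≤ lam + 1 := by
    have h1 : Nat.clog 2 n ≤ Nat.log 2 n + 1 := by
      exact Nat.clog_le_of_le_pow (Nat.lt_pow_succ_log_self one_lt_two n).le
    have h2 := Real.natLog_le_logb n 2
    push_cast at h2
    have h3 : (Nat.clog 2 n : ℝ) ≤ Nat.log 2 n + 1 := by exact_mod_cast h1
    linarith
  have hX0 : 0 ≤ X := by linarith
  have hlam0 : 0 ≤ lam := by linarith
  have hD0 : 0 ≤ D := by linarith
  -- the two quantities in which everything is measured
  set Y : ℝ := n * D * lam ^ 3 * X with hY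
  set Z : ℝ := n * D * lam ^ 4 * X with hZ
  have hlam3 : 1 ≤ lam ^ 3 := one_le_pow₀ hlam1
  have hYX : X ≤ Y := by
    have : 1 ≤ n * D * lam ^ 3 := by
      have := one_le_mul_of_one_le_of_one_le (by linarith : (1 : ℝ) ≤ n) hD1
      exact one_le_mul_of_one_le_of_one_le this hlam3
    nlinarith
  have hYZ : lam * Y = Z := by rw [hY, hZ]; ring
  have hY0 : 0 ≤ Y := by linarith
  have hYZ' : Y ≤ Z := by nlinarith
  have hnX : n * X ≤ Y := by
    have : 1 ≤ D * lam ^ 3 := one_le_mul_of_one_le_of_one_le hD1 hlam3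
    have h2 : 0 ≤ n * X := by positivity
    calc n * X = n * X * 1 := (mul_one _).symm
      _ ≤ n * X * (D * lam ^ 3) := by gcongr
      _ = Y := by rw [hY]; ring
  have hnY : (n : ℝ) ≤ Y := le_trans (by nlinarith) hnX
  have hN : (P.N : ℝ) ≤ 38913 * Y := by
    have h0 : 0 ≤ 64 * n * (P.L : ℝ) ^ 2 * Real.log n * P.g * P.T := by positivity
    have h1 := (Nat.ceil_lt_add_one h0).le
    change (P.N : ℝ) ≤ 64 * n * (P.L : ℝ) ^ 2 * Real.log n * P.g * P.T + 1 at h1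
    have h2 : 64 * n * (P.L : ℝ) ^ 2 * Real.log n * P.g * P.T ≤
        64 * n * (4 * lam) ^ 2 * lam * (2 * D) * (19 * X) := by gcongr
    have h3 : 64 * n * (4 * lam) ^ 2 * lam * (2 * D) * (19 * X) = 38912 * Y := by rw [hY]; ring
    linarith
  have haY : (a : ℝ) ≤ 6 * Y := by
    have h1 : (Nat.clog 2 n : ℝ) + 1 ≤ 3 * lam := by linarith
    have h2 : D * (2 * (n * ((Nat.clog 2 n : ℝ) + 1))) ≤ D * (2 * (n * (3 * lam))) := by gcongr
    have h3 : D * (2 * (n * (3 * lam))) ≤ 6 * Y := by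
      have h4 : 1 ≤ lam ^ 2 * X := one_le_mul_of_one_le_of_one_le (one_le_pow₀ hlam1) hX1
      calc D * (2 * (n * (3 * lam))) = 6 * (n * D * lam) * 1 := by ring
        _ ≤ 6 * (n * D * lam) * (lam ^ 2 * X) := by gcongr
        _ = 6 * Y := by rw [hY]; ring
    linarith
  have hTn : (4 * n + 1) * (P.T : ℝ) ≤ 95 * Y := by
    calc (4 * n + 1) * (P.T : ℝ) ≤ (5 * n) * (19 * X) := by gcongr; linarith
      _ = 95 * (n * X) := by ring
      _ ≤ 95 * Y := by gcongr
  have hNL : (4 * (P.N : ℝ) + 1) * P.L ≤ 622612 * Z := by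
    calc (4 * (P.N : ℝ) + 1) * P.L ≤ (155653 * Y) * (4 * lam) := by gcongr; linarith
      _ = 622612 * Z := by rw [← hYZ]; ring
  have hpass : ((P.T + 2 : ℕ) : ℝ) ≤ 21 * X := by push_cast; linarith
  refine ⟨?_, hpass.trans (by linarith)⟩
  have hword : (wordCount n (P.T + 2) a P.T P.N P.L : ℝ) ≤ 10 ^ 6 * Z := by
    rw [wordCount]
    push_cast at hpass ⊢
    linarith
  refine hword.trans ?_
  have hrpow : (n : ℝ) ^ (1 + 1 / (k : ℝ)) = n * D := by
    rw [Real.rpow_add hn0, Real.rpow_one]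
  rw [hrpow]
  have hXε : X ≤ (k : ℝ) ^ 2 / ε ^ 2 := by
    rw [hX]
    gcongr
    nlinarith
  calc 10 ^ 6 * Z = 10 ^ 6 * (X * (n * D) * lam ^ 4) := by rw [hZ]; ring
    _ ≤ _ := by gcongr

end Choice

end StreamSSSP

theorem theoremA1 :
    ∃ C : ℝ, 0 < C ∧
      ∀ (n k b : ℕ) (ε : ℝ) (W : Finset ℝ≥0),
        1 ≤ k → (k : ℝ) ≤ Real.log n → 0 < ε → ε < 1 →
        -- a word can hold the name of a vertex and the weight of an edge
        n ≤ 2 ^ b → W.card ≤ 2 ^ b →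
        ∃ (m p : ℕ) (A : StreamSSSP.DetAlgorithm n m b),
          -- space, in words
          (m : ℝ) ≤ C * ((k : ℝ) ^ 2 / ε ^ 2 * (n : ℝ) ^ (1 + 1 / (k : ℝ)) *
            Real.logb 2 n ^ 4) ∧
          -- passes
          (p : ℝ) ≤ C * ((k : ℝ) ^ 2 / ε) ∧
          ∀ (G : SimpleGraph (Fin n)) (w : Sym2 (Fin n) → ℝ≥0) (s : Fin n)
            (σ : List (StreamSSSP.Item n)),
            (∀ e ∈ G.edgeSet, w e ∈ W) →
            StreamSSSP.IsInsertionStream G w σ →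
            StreamSSSP.IsApproxShortestPathTree G w s (1 + ε) (A.run p s σ) := by
  refine ⟨10 ^ 6, by norm_num, fun n k b ε W hk hkn hε hε1 hn hW ↦ ?_⟩
  have hD : (0 : ℝ) ≤ (n : ℝ) ^ (1 / (k : ℝ)) := by positivity
  have hP := StreamSSSP.chooseParameters_valid hk hkn hε
  obtain ⟨A, hA⟩ := StreamSSSP.exists_detAlgorithm_of_valid hP hε
    (by rw [← div_le_iff₀' hε]; exact Nat.le_ceil _) hn hW hD
    (StreamSSSP.rpow_pow_eq hk).ge (Nat.lt_floor_add_one _)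
  obtain ⟨h1, h2⟩ := StreamSSSP.wordCount_chooseParameters_le hk hkn hε hε1
    (Nat.floor_le (by positivity))
  exact ⟨_, _, A, h1, h2, hA⟩
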